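/- Let $\mathbb T=\mathbb R\cup\{\infty\}$ be the tropical (min-plus) semi-field with its order topology, let $d\ge 2$, let $a\in\mathbb R^d$ have strictly positive entries, and let $S=(\mathbb T^d\setminus\{(\infty,\dots,\infty)\})/\langle F\rangle$ be the diagonal tropical Hopf manifold of the translation $F(x)=x+a$. Let $\mathcal O_S^*$ be the sheaf of tropical invertible regular functions: its sections over an open set are the real-valued functions which near each point $x$ are of the form $c+\sum_i m_ix_i$ with $c\in\mathbb R$, $m_i\in\mathbb Z$, and $m_i=0$ whenever the $i$-th coordinate of the point is $\infty$. Then: (1) The Picard group $\operatorname{Pic}(S)=H^1(S,\mathcal O_S^*)$ is isomorphic, as a group, to $(\mathbb R,+)$. (2) Every tropical line bundle on $S$ has a tropical section and is represented by a tropical divisor. That is, for every open cover $\{U_i\}$ of $S$ and every cocycle $\tau_{ij}\in\mathcal O_S^*(U_i\cap U_j)$ there are tropical rational functions $f_i$ on $U_i$ (locally differences of tropical polynomial functions) with $f_i-f_j=\tau_{ij}$ on $U_i\cap U_j$; their divisors $\operatorname{div}(f_i)$ agree on overlaps and form a tropical divisor on $S$ (a codimension one cycle which is locally the divisor of a tropical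 rational function, with integer, possibly negative, weights), and the class of this divisor in $\operatorname{Pic}(S)$ is the class of $\tau$. In particular every element of $\operatorname{Pic}(S)$ is the class of a tropical divisor. -/

import Mathlib

open Topology TopologicalSpace

namespace TropHopf

noncomputable section

/-! ### The diagonal tropical Hopf manifold

The tropical semi-field `𝕋 = ℝ ∪ {∞}` (min-plus convention) is `WithTop ℝ` with its order topology;
this topology is generated by the Euclidean topology of `ℝ` and the sets `(a, ∞]`. -/

/-- The punctured tropical affine space `𝕋ᵈ \ {(∞, …, ∞)}`. -/
abbrev Punctured (d : ℕ) : Type := {x : Fin d → WithTop ℝ // x ≠ fun _ => ⊤}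

/-- A point of `𝕋ᵈ` is finite (of empty sedentarity) if it lies in `ℝᵈ`. -/
def IsFinite {d : ℕ} (x : Punctured d) : Prop := ∀ i, x.1 i ≠ ⊤

/-- The real value of the `i`-th coordinate (used only where the coordinate is finite,
or multiplied by the coefficient `0`). -/
def coord {d : ℕ} (x : Punctured d) (i : Fin d) : ℝ := (x.1 i).untopD 0

/-- Two points are in the same orbit of the group generated by the translation
`F x = x + a` if they differ by an integer multiple of `a`. -/
def orbitSetoid {d : ℕ} (a : Fin d → ℝ) : Setoid (Punctured d) where
  r x y := ∃ n : ℤ, ∀ i, y.1 i = x.1 i + ((n * a i : ℝ) : WithTop ℝ)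
  iseqv := by
    refine ⟨fun x => ⟨0, fun i => by simp⟩, ?_, ?_⟩
    · rintro x y ⟨n, h⟩
      refine ⟨-n, fun i => ?_⟩
      rw [h i, add_assoc, ← WithTop.coe_add]
      simp
    · rintro x y z ⟨n, h⟩ ⟨k, h'⟩
      refine ⟨n + k, fun i => ?_⟩
      rw [h' i, h i, add_assoc, ← WithTop.coe_add]
      rw [← add_mul, Int.cast_add]

/-- The tropical Hopf manifold `S = (𝕋ᵈ \ {∞}) / ⟨F⟩`, `F x = x + a`, with the quotient topology. -/
def Hopf {d : ℕ} (a : Fin d → ℝ) : Type := Quotient (orbitSetoid a)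

instance {d : ℕ} (a : Fin d → ℝ) : TopologicalSpace (Hopf a) :=
  inferInstanceAs (TopologicalSpace (Quotient (orbitSetoid a)))

/-- The projection `𝕋ᵈ \ {∞} → S`. -/
def proj {d : ℕ} (a : Fin d → ℝ) (x : Punctured d) : Hopf a := Quotient.mk (orbitSetoid a) x

/-! ### The sheaf of tropical invertible regular functions -/

/-- A function `f : U → ℝ` on an open subset of `S` is tropical invertible regular if near every
point `x` it is an integer affine function (a tropical Laurent monomial) that does not involve the
coordinates which are infinite at `x`. -/
def IsInvertibleRegular {d : ℕ} {a : Fin d → ℝ} (U : Opens (Hopf a)) (f : U → ℝ) : Prop :=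
  ∀ x : Punctured d, proj a x ∈ U →
    ∃ (m : Fin d → ℤ) (c : ℝ), (∀ i, x.1 i = ⊤ → m i = 0) ∧
      ∀ᶠ y in 𝓝 x, ∀ hy : proj a y ∈ U,
        f ⟨proj a y, hy⟩ = c + ∑ i, (m i : ℝ) * coord y i

/-- The group `𝒪*(U)`. The condition is local, so `U ↦ 𝒪*(U)` is a sheaf of abelian groups. -/
def OStar {d : ℕ} {a : Fin d → ℝ} (U : Opens (Hopf a)) : AddSubgroup (U → ℝ) where
  carrier := {f | IsInvertibleRegular U f}
  zero_mem' := fun x _ => ⟨0, 0, by simp, by simp⟩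
  add_mem' := by
    intro f g hf hg x hx
    obtain ⟨m, c, h0, h⟩ := hf x hx
    obtain ⟨m', c', h0', h'⟩ := hg x hx
    refine ⟨m + m', c + c', fun i hi => by simp [h0 i hi, h0' i hi], ?_⟩
    filter_upwards [h, h'] with y hy hy' hU
    rw [Pi.add_apply, hy hU, hy' hU]
    simp only [Pi.add_apply, Int.cast_add, add_mul, Finset.sum_add_distrib]
    ring
  neg_mem' := by
    intro f hf x hx
    obtain ⟨m, c, h0, h⟩ := hf x hx
    refine ⟨-m, -c, fun i hi => by simp [h0 i hi], ?_⟩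
    filter_upwards [h] with y hy hU
    rw [Pi.neg_apply, hy hU]
    simp only [Pi.neg_apply, Int.cast_neg, neg_mul, Finset.sum_neg_distrib]
    ring

/-- Restriction `𝒪*(U) → 𝒪*(V)` for `V ⊆ U`. -/
def OStar.res {d : ℕ} {a : Fin d → ℝ} {U V : Opens (Hopf a)} (h : V ≤ U) :
    OStar U →+ OStar V where
  toFun f := ⟨fun p => f.1 ⟨p.1, h p.2⟩, fun x hx => by
    obtain ⟨m, c, h0, h'⟩ := f.2 x (h hx)
    refine ⟨m, c, h0, ?_⟩
    filter_upwards [h'] with y hy hV using hy (h hV)⟩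
  map_zero' := rfl
  map_add' _ _ := rfl

/-! ### First cohomology -/

/-- Čech `1`-cocycles of `𝒪*` on a family of open sets. -/
def Cocycle {d : ℕ} {a : Fin d → ℝ} {ι : Type*} (U : ι → Opens (Hopf a)) :
    AddSubgroup (∀ i j, OStar (U i ⊓ U j)) where
  carrier := {τ | ∀ i j k (p : Hopf a) (hi : p ∈ U i) (hj : p ∈ U j) (hk : p ∈ U k),
    (τ i j).1 ⟨p, hi, hj⟩ + (τ j k).1 ⟨p, hj, hk⟩ = (τ i k).1 ⟨p, hi, hk⟩}
  zero_mem' := fun i j k p hi hj hk => add_zero (0 : ℝ)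
  add_mem' := by
    intro σ τ hσ hτ i j k p hi hj hk
    have h1 := hσ i j k p hi hj hk
    have h2 := hτ i j k p hi hj hk
    simp only [Pi.add_apply, AddSubgroup.coe_add]
    linarith
  neg_mem' := by
    intro τ hτ i j k p hi hj hk
    have h1 := hτ i j k p hi hj hk
    simp only [Pi.neg_apply, AddSubgroup.coe_neg]
    linarith

/-- The coboundary `(δσ)ᵢⱼ = σᵢ - σⱼ` of a `0`-cochain. -/
def coboundary {d : ℕ} {a : Fin d → ℝ} {ι : Type*} (U : ι → Opens (Hopf a)) :
    (∀ i, OStar (U i)) →+ Cocycle U where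
  toFun σ := ⟨fun i j => OStar.res inf_le_left (σ i) - OStar.res inf_le_right (σ j), by
    intro i j k p hi hj hk
    exact sub_add_sub_cancel ((σ i).1 ⟨p, hi⟩) ((σ j).1 ⟨p, hj⟩) ((σ k).1 ⟨p, hk⟩)⟩
  map_zero' := by
    apply Subtype.ext
    funext i j
    simp
  map_add' σ τ := by
    apply Subtype.ext
    funext i j
    simp only [Pi.add_apply, map_add, AddSubgroup.coe_add]
    abel

/-- The first Čech cohomology group of `𝒪*` with respect to a fixed family of open sets. -/
abbrev CechH1 {d : ℕ} {a : Fin d → ℝ} {ι : Type*} (U : ι → Opens (Hopf a)) : Type _ :=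
  Cocycle U ⧸ (coboundary U).range

/-- Pull-back of cocycles along a refinement `V k ⊆ U (φ k)`. -/
def Cocycle.refine {d : ℕ} {a : Fin d → ℝ} {ι κ : Type*} {U : ι → Opens (Hopf a)}
    {V : κ → Opens (Hopf a)} (φ : κ → ι) (h : ∀ k, V k ≤ U (φ k)) :
    Cocycle U →+ Cocycle V where
  toFun τ := ⟨fun k l => OStar.res (inf_le_inf (h k) (h l)) (τ.1 (φ k) (φ l)),
    fun i j k p hi hj hk =>
      τ.2 (φ i) (φ j) (φ k) p (h i hi) (h j hj) (h k hk)⟩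
  map_zero' := rfl
  map_add' _ _ := rfl

/-- The map on Čech cohomology induced by a refinement. -/
def CechH1.refine {d : ℕ} {a : Fin d → ℝ} {ι κ : Type*} {U : ι → Opens (Hopf a)}
    {V : κ → Opens (Hopf a)} (φ : κ → ι) (h : ∀ k, V k ≤ U (φ k)) :
    CechH1 U →+ CechH1 V :=
  QuotientAddGroup.map _ _ (Cocycle.refine φ h) (by
    rintro _ ⟨σ, rfl⟩
    exact ⟨fun k => OStar.res (h k) (σ (φ k)), rfl⟩)

/-- Open covers of `S` indexed by the points of `S`, with `p ∈ U p`. Every open cover has a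
refinement of this form, so these covers are cofinal among all open covers. -/
abbrev PointedCover {d : ℕ} (a : Fin d → ℝ) : Type :=
  {U : Hopf a → Opens (Hopf a) // ∀ p, p ∈ U p}

instance {d : ℕ} (a : Fin d → ℝ) : DecidableEq (PointedCover a)ᵒᵈ := Classical.decEq _

/-- The Picard group `Pic(S) = H¹(S, 𝒪*)`: the direct limit, over all open covers ordered by
refinement, of the first Čech cohomology groups (in degree one this is sheaf cohomology). -/
abbrev Pic {d : ℕ} (a : Fin d → ℝ) : Type :=
  AddCommGroup.DirectLimit (ι := (PointedCover a)ᵒᵈ)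
    (fun U => CechH1 (OrderDual.ofDual U).1)
    (fun _ _ h => CechH1.refine id fun p => (OrderDual.ofDual_le_ofDual.mpr h) p)

/-- The class in `Pic(S)` of a cocycle on a pointed cover. -/
def Pic.mk {d : ℕ} {a : Fin d → ℝ} (U : PointedCover a) (τ : Cocycle U.1) : Pic a :=
  AddCommGroup.DirectLimit.of (ι := (PointedCover a)ᵒᵈ)
    (fun U => CechH1 (OrderDual.ofDual U).1)
    (fun _ _ h => CechH1.refine id fun p => (OrderDual.ofDual_le_ofDual.mpr h) p)
    (OrderDual.toDual U) (QuotientAddGroup.mk τ)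

/-- A tropical line bundle on `S`, given by transition functions in `𝒪*` on an open cover. -/
structure LineBundle {d : ℕ} (a : Fin d → ℝ) where
  /-- index set of the trivializing cover -/
  ι : Type*
  /-- trivializing cover -/
  U : ι → Opens (Hopf a)
  covers : ∀ p, ∃ i, p ∈ U i
  /-- transition functions -/
  τ : Cocycle U

/-- The class of a line bundle in `Pic(S)`; it does not depend on the choice of the index
`i` with `p ∈ U i` for each point `p`. -/
def LineBundle.toPic {d : ℕ} {a : Fin d → ℝ} (L : LineBundle a) : Pic a :=
  Pic.mk ⟨fun p => L.U (L.covers p).choose, fun p => (L.covers p).choose_spec⟩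
    (Cocycle.refine (fun p => (L.covers p).choose) (fun _ => le_rfl) L.τ)

/-! ### Tropical rational functions, sections and divisors -/

/-- A tropical polynomial in `d` variables with a non-empty set of monomials. -/
structure TropPoly (d : ℕ) where
  /-- exponents that occur -/
  exps : Finset (Fin d → ℕ)
  nonempty : exps.Nonempty
  /-- coefficients -/
  coeff : (Fin d → ℕ) → ℝ

/-- The tropical polynomial function `P x = min_I (c_I + ⟨I, x⟩)` on `𝕋ᵈ`. -/
def TropPoly.eval {d : ℕ} (P : TropPoly d) (x : Fin d → WithTop ℝ) : WithTop ℝ :=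
  P.exps.inf fun I => (P.coeff I : WithTop ℝ) + ∑ i, I i • x i

/-- The points of `U` of empty sedentarity; a dense open subset of `U`. -/
def finitePart {d : ℕ} {a : Fin d → ℝ} (U : Opens (Hopf a)) : Set (Hopf a) :=
  {p | p ∈ U ∧ ∃ x : Punctured d, IsFinite x ∧ proj a x = p}

/-- The point of `finitePart U` given by a lift. -/
def finitePoint {d : ℕ} {a : Fin d → ℝ} {U : Opens (Hopf a)} (y : Punctured d)
    (hy : proj a y ∈ U) (hf : IsFinite y) : finitePart U :=
  ⟨proj a y, hy, y, hf, rfl⟩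

/-- A tropical rational function on `U`: near every point of `U` (of any sedentarity) it is a
difference `P - Q` of tropical polynomial functions. As such a difference may be infinite or
undefined at points of non-empty sedentarity, it is recorded by its values on the dense part of
finite points, where it is real-valued. -/
structure RatFun {d : ℕ} {a : Fin d → ℝ} (U : Opens (Hopf a)) where
  /-- the values at finite points -/
  toFun : finitePart U → ℝ
  isRational : ∀ x : Punctured d, proj a x ∈ U → ∃ P Q : TropPoly d,
    ∀ᶠ y in 𝓝 x, ∀ (hy : proj a y ∈ U) (hf : IsFinite y),
      (toFun (finitePoint y hy hf) : WithTop ℝ) + Q.eval y.1 = P.eval y.1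

/-- `f` vanishes along a codimension one face through `x` to order `w`. Either `x` is finite and
near `x` the function is `c + ⟨m, y⟩ + w * min (⟨n, y - x⟩, 0)`, so that its slopes on the two
sides of the rational hyperplane with primitive integer normal vector `n` differ by `w * n`;
or exactly one coordinate `i` of `x` is infinite and near `x` the function is integer affine
with coefficient `w` at the `i`-th coordinate (order along the boundary divisor `x i = ∞`). -/
def RatFun.HasMult {d : ℕ} {a : Fin d → ℝ} {U : Opens (Hopf a)} (f : RatFun U)
    (x : Punctured d) (w : ℤ) : Prop :=
  (IsFinite x ∧ ∃ (n m : Fin d → ℤ) (c : ℝ), Finset.univ.gcd n = 1 ∧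
    ∀ᶠ y in 𝓝 x, ∀ (hy : proj a y ∈ U) (hf : IsFinite y),
      f.toFun (finitePoint y hy hf) = c + ∑ j, (m j : ℝ) * coord y j +
        (w : ℝ) * min (∑ j, (n j : ℝ) * (coord y j - coord x j)) 0) ∨
  (∃ i, (∀ j, x.1 j = ⊤ ↔ j = i) ∧ ∃ (m : Fin d → ℤ) (c : ℝ), m i = w ∧
    ∀ᶠ y in 𝓝 x, ∀ (hy : proj a y ∈ U) (hf : IsFinite y),
      f.toFun (finitePoint y hy hf) = c + ∑ j, (m j : ℝ) * coord y j)

open Classical in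
/-- The weight of the divisor of `f` at `x`: the order of vanishing at generic points of
codimension one, and `0` at points of higher codimension in the stratification by `f`. -/
def RatFun.mult {d : ℕ} {a : Fin d → ℝ} {U : Opens (Hopf a)} (f : RatFun U)
    (x : Punctured d) : ℤ :=
  if h : ∃ w, f.HasMult x w then h.choose else 0

/-- A codimension one cycle is encoded by its integer weight at the generic (relative interior)
points of its facets, extended by `0` elsewhere. `IsDivOf D f` says that the cycle `D` coincides
on `U` with the divisor `div f`. -/
def IsDivOf {d : ℕ} {a : Fin d → ℝ} (D : Hopf a → ℤ) {U : Opens (Hopf a)} (f : RatFun U) : Prop :=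
  ∀ x : Punctured d, proj a x ∈ U → D (proj a x) = f.mult x

/-- A tropical divisor on `S`: a codimension one cycle that is locally the divisor of a tropical
rational function. -/
structure Divisor {d : ℕ} (a : Fin d → ℝ) where
  /-- the weights -/
  weight : Hopf a → ℤ
  locally_div : ∀ p, ∃ (U : Opens (Hopf a)) (_ : p ∈ U) (f : RatFun U), IsDivOf weight f

/-- The relation `fᵢ - fⱼ = τᵢⱼ` between rational functions on the sets of a cover and a
cocycle. -/
def IsSectionOf {d : ℕ} {a : Fin d → ℝ} {ι : Type*} {U : ι → Opens (Hopf a)}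
    (τ : Cocycle U) (f : ∀ i, RatFun (U i)) : Prop :=
  ∀ i j (y : Punctured d) (hi : proj a y ∈ U i) (hj : proj a y ∈ U j) (hf : IsFinite y),
    (f i).toFun (finitePoint y hi hf) - (f j).toFun (finitePoint y hj hf)
      = (τ.1 i j).1 ⟨proj a y, hi, hj⟩

/-- A tropical (rational) section of a line bundle. -/
structure LineBundle.RatSection {d : ℕ} {a : Fin d → ℝ} (L : LineBundle a) where
  /-- the section in the given trivializations -/
  toFun : ∀ i, RatFun (L.U i)
  isSection : IsSectionOf L.τ toFun

/-- The divisor of a section is `D`. -/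
def LineBundle.RatSection.HasDivisor {d : ℕ} {a : Fin d → ℝ} {L : LineBundle a}
    (s : L.RatSection) (D : Divisor a) : Prop :=
  ∀ i, IsDivOf D.weight (s.toFun i)

/-- `D` represents the class `c`: for local equations `f_p` of `D` on some open cover, `c` is the
class of the cocycle `f_p - f_q`. -/
def Divisor.Represents {d : ℕ} {a : Fin d → ℝ} (D : Divisor a) (c : Pic a) : Prop :=
  ∃ (U : PointedCover a) (f : ∀ p, RatFun (U.1 p)) (τ : Cocycle U.1),
    (∀ p, IsDivOf D.weight (f p)) ∧ IsSectionOf τ f ∧ Pic.mk U τ = c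

end

end TropHopf

/-! Everything is computed on X = 𝕋ᵈ \ {∞}, where ⟨F⟩ acts with quotient S. Two facts about X carry
the proof, both using d ≥ 2: every 𝒪*-cocycle on an open cover of X is a coboundary
(`exists_regular_primitive`), and global sections of 𝒪* on X are constant
(`exists_const_of_regular`). The first follows from simple connectedness of ℝᵈ, the density of ℝᵈ in
X and the connectedness of the facets x_l = ∞.

Given a cocycle τ on S, write its pull-back as σᵢ - σⱼ. Since τ is F-invariant, the differences σᵢ ∘
F - σᵢ agree on overlaps and glue to a global section, that is, to a constant c. This c is the
degree of τ. It is independent of σ, additive and compatible with refinement. If c = 0, the σᵢ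
descend to S and τ is a coboundary, so `Pic.degree` is injective. It is surjective because floors of
the function min xᵢ/aᵢ, which grows by 1 under F, are locally constant functions away from a level
set and grow by 1 too.

For sections, `exists_quasiPeriodic` gives a tropical rational function h on X with h ∘ F = h - c.
Then σᵢ + h is F-invariant, descends to a rational function fᵢ, and fᵢ - fⱼ = τᵢⱼ. Orders of
vanishing do not change when an invertible regular function is added, so the fᵢ have a common
divisor. -/

namespace TropHopf

noncomputable section

open Filter Set

/-! ### Locally constant cocycles -/

/-- A locally constant `1`-cocycle on a simply connected space is a coboundary. -/
theorem exists_locallyConstant_primitive {A B ι : Type*} [AddCommGroup A] [TopologicalSpace B]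
    [SimplyConnectedSpace B] [LocallyPathConnectedSpace B] (W : ι → Set B)
    (hW : ∀ i, IsOpen (W i)) (hcov : ∀ x, ∃ i, x ∈ W i) (g : ι → ι → B → A)
    (hg : ∀ i j, ∀ x ∈ W i, x ∈ W j → ∀ᶠ y in 𝓝 x, g i j y = g i j x)
    (hc : ∀ i j k x, x ∈ W i → x ∈ W j → x ∈ W k → g i j x + g j k x = g i k x) :
    ∃ s : ι → B → A, (∀ i, ∀ x ∈ W i, ∀ᶠ y in 𝓝 x, s i y = s i x) ∧
      ∀ i j x, x ∈ W i → x ∈ W j → g i j x = s i x - s j x := by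
  let _ : TopologicalSpace A := ⊥
  have : DiscreteTopology A := ⟨rfl⟩
  choose ind hind using hcov
  have hself : ∀ i, ∀ x ∈ W i, g i i x = 0 := fun i x hx => by
    simpa using hc i i i x hx hx hx
  -- The bundle with discrete fibre `A`, glued by the translations `v ↦ v - g i j x`, is a covering
  -- of `B`. Simple connectedness gives it a global section, whose coordinates in the local
  -- trivializations are the primitive.
  let Z : FiberBundleCore ι B A :=
    { baseSet := W
      isOpen_baseSet := hW
      indexAt := ind
      mem_baseSet_at := hind
      coordChange := fun i j x v => v - g i j x
      coordChange_self := fun i x hx v => by simp [hself i x hx]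
      continuousOn_coordChange := fun i j => by
        rintro ⟨x, v⟩ ⟨⟨hi, hj⟩, -⟩
        apply ContinuousAt.continuousWithinAt
        have h1 : ∀ᶠ p : B × A in 𝓝 (x, v), g i j p.1 = g i j x :=
          (continuous_fst.tendsto (x, v)).eventually (hg i j x hi hj)
        have h2 : ContinuousAt (fun p : B × A => p.2 - g i j x) (x, v) :=
          (continuous_of_discreteTopology (f := fun v : A => v - g i j x)).continuousAt.comp
            continuous_snd.continuousAt
        refine h2.congr ?_
        filter_upwards [h1] with p hp
        rw [hp]
      coordChange_comp := fun i j k x hx v => by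
        rw [← hc i j k x hx.1.1 hx.1.2 hx.2]
        abel }
  obtain ⟨x₀⟩ : Nonempty B := inferInstance
  have hcover : IsCoveringMap (Bundle.TotalSpace.proj : Bundle.TotalSpace A Z.Fiber → B) :=
    FiberBundle.isCoveringMap
  obtain ⟨F, ⟨-, hF⟩, -⟩ := hcover.existsUnique_continuousMap_lifts
    (ContinuousMap.id B) x₀ (⟨x₀, (0 : A)⟩ : Bundle.TotalSpace A Z.Fiber) rfl
  have hF' : ∀ x, (F x).1 = x := fun x => congrFun hF x
  have hs : ∀ x, ∃ v : A, ∀ i, (Z.localTriv i (F x)).2 = v - g (ind x) i x := fun x =>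
    ⟨(F x).2, fun i => by
      rw [Z.localTriv_apply]
      exact congrArg (fun y => @id A (F x).2 - g (ind y) i y) (hF' x)⟩
  refine ⟨fun i x => (Z.localTriv i (F x)).2, fun i x hx => ?_, fun i j x hi hj => ?_⟩
  · have h1 : ContinuousAt (Z.localTriv i) (F x) := by
      apply (Z.localTriv i).continuousAt
      rw [(Z.localTriv i).mem_source]
      change (F x).1 ∈ W i
      rwa [hF']
    have h2 : ContinuousAt (fun y => (Z.localTriv i (F y)).2) x :=
      continuous_snd.continuousAt.comp (h1.comp F.continuous.continuousAt)
    rwa [ContinuousAt, nhds_discrete A, tendsto_pure] at h2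
  · obtain ⟨v, hv⟩ := hs x
    simp only [hv]
    rw [← hc (ind x) i j x (hind x) hi hj]
    abel

/-! ### Finite points of the punctured space -/

variable {d : ℕ}

theorem continuous_val : Continuous fun x : Punctured d => x.1 := continuous_subtype_val

theorem continuous_val_apply (i : Fin d) : Continuous fun x : Punctured d => x.1 i :=
  (continuous_apply i).comp continuous_val

theorem coe_coord {x : Punctured d} {i : Fin d} (h : x.1 i ≠ ⊤) : (coord x i : WithTop ℝ) = x.1 i :=
by
  lift x.1 i to ℝ using h with r hr
  simp [coord, ← hr]

/-- Sedentarity can only drop nearby, so a monomial that is invertible at a point stays invertible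
around it. -/
theorem eventually_ne_top (x : Punctured d) : ∀ᶠ y in 𝓝 x, ∀ i, y.1 i = ⊤ → x.1 i = ⊤ := by
  rw [eventually_all]
  intro i
  by_cases h : x.1 i = ⊤
  · simp [h]
  · filter_upwards [(continuous_val_apply i).continuousAt.eventually (isOpen_ne.mem_nhds h)]
      with y hy hy' using absurd hy' hy

theorem exists_box {x : Punctured d} {V : Set (Punctured d)} (hV : V ∈ 𝓝 x) :
    ∃ b c : Fin d → WithTop ℝ, {y : Punctured d | ∀ i, y.1 i ∈ Icc (b i) (c i)} ∈ 𝓝 x ∧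
      {y : Punctured d | ∀ i, y.1 i ∈ Icc (b i) (c i)} ⊆ V := by
  rw [nhds_induced] at hV
  obtain ⟨s, hs, hsV⟩ := hV
  rw [nhds_pi, Filter.mem_pi'] at hs
  obtain ⟨I, t, ht, hts⟩ := hs
  choose b c hx hn hsub using fun i => exists_Icc_mem_subset_of_mem_nhds (ht i)
  refine ⟨b, c, ?_, fun y hy => hsV (hts fun i _ => hsub i (hy i))⟩
  change ∀ᶠ y : Punctured d in 𝓝 x, ∀ i, y.1 i ∈ Icc (b i) (c i)
  rw [eventually_all]
  exact fun i => (continuous_val_apply i).continuousAt.eventually (hn i)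

section

variable [Nonempty (Fin d)]

/-- The inclusion `ℝᵈ → 𝕋ᵈ \ {∞}`. -/
def ofReal (y : Fin d → ℝ) : Punctured d :=
  ⟨fun i => y i, fun h => by
    obtain ⟨i⟩ := ‹Nonempty (Fin d)›
    exact WithTop.coe_ne_top (congrFun h i)⟩

@[simp] theorem coord_ofReal (y : Fin d → ℝ) (i : Fin d) : coord (ofReal y) i = y i := rfl

theorem continuous_ofReal : Continuous (ofReal (d := d)) :=
  Continuous.subtype_mk
    (continuous_pi fun i => WithTop.continuous_coe.comp (continuous_apply i)) _

/-- The finite point obtained by replacing the infinite coordinates of `x` by `n`. -/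
def truncate (x : Punctured d) (n : ℕ) (i : Fin d) : ℝ :=
  open Classical in if x.1 i = ⊤ then n else coord x i

theorem tendsto_coe_natCast : Tendsto (fun n : ℕ => ((n : ℝ) : WithTop ℝ)) atTop (𝓝 ⊤) := by
  rw [WithTop.tendsto_nhds_top_iff]
  intro r
  filter_upwards [eventually_gt_atTop ⌈r⌉₊] with n hn
  exact WithTop.coe_lt_coe.2 ((Nat.le_ceil r).trans_lt (by exact_mod_cast hn))

theorem tendsto_truncate (x : Punctured d) :
    Tendsto (fun n => ofReal (truncate x n)) atTop (𝓝 x) := by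
  rw [tendsto_subtype_rng, tendsto_pi_nhds]
  intro i
  by_cases h : x.1 i = ⊤
  · simpa [ofReal, truncate, h] using tendsto_coe_natCast
  · simp [ofReal, truncate, h, coe_coord h]

theorem exists_ofReal_of_eventually {x : Punctured d} {p : Punctured d → Prop}
    (h : ∀ᶠ y in 𝓝 x, p y) : ∃ z, p (ofReal z) :=
  let ⟨_, hn⟩ := ((tendsto_truncate x).eventually h).exists
  ⟨_, hn⟩

/-- A locally constant function on the finite points of an open set extends to a locally constant
function on the open set. -/
theorem exists_locallyConstant_extension {A : Type*} [Nonempty A] {W : Set (Punctured d)}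
    (hW : IsOpen W) (s : (Fin d → ℝ) → A)
    (hs : ∀ z, ofReal z ∈ W → ∀ᶠ y in 𝓝 z, s y = s z) :
    ∃ s' : Punctured d → A, (∀ x ∈ W, ∀ᶠ y in 𝓝 x, s' y = s' x) ∧
      ∀ z, ofReal z ∈ W → s' (ofReal z) = s z := by
  let _ : TopologicalSpace A := ⊥
  have : DiscreteTopology A := ⟨rfl⟩
  have key : ∀ x ∈ W, ∃ α, ∀ᶠ y in 𝓝 x, ∀ z, ofReal z = y → s z = α := by
    intro x hx
    obtain ⟨b, c, hn, hsub⟩ := exists_box (hW.mem_nhds hx)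
    set V := {y : Punctured d | ∀ i, y.1 i ∈ Icc (b i) (c i)}
    -- The finite points of a box form a product of order-connected subsets of ℝ, hence a convex
    -- set; `s` is constant there, and its value is the extension.
    have hpre : IsPreconnected (ofReal ⁻¹' V) := by
      apply Convex.isPreconnected
      have : ofReal ⁻¹' V = univ.pi fun i => ((↑) : ℝ → WithTop ℝ) ⁻¹' Icc (b i) (c i) := by
        ext y
        simp [V, ofReal]
      rw [this]
      refine convex_pi fun i _ => Set.OrdConnected.convex ?_
      exact ordConnected_Icc.preimage_mono WithTop.coe_mono
    obtain ⟨z₀, hz₀⟩ := exists_ofReal_of_eventually (x := x) hn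
    have hcont : ContinuousOn s (ofReal ⁻¹' V) := by
      intro z hz
      apply ContinuousAt.continuousWithinAt
      rw [ContinuousAt, nhds_discrete A, tendsto_pure]
      exact hs z (hsub hz)
    refine ⟨s z₀, ?_⟩
    filter_upwards [hn] with y hy z hz
    subst hz
    exact hpre.constant hcont hy hz₀
  choose! s' hs' using key
  refine ⟨s', fun x hx => ?_, fun z hz => ?_⟩
  · filter_upwards [eventually_eventually_nhds.2 (hs' x hx), hW.mem_nhds hx] with y hy hyW
    obtain ⟨z, h1, h2⟩ := exists_ofReal_of_eventually (hy.and (hs' y hyW))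
    rw [← h1 z rfl, ← h2 z rfl]
  · exact ((hs' _ hz).self_of_nhds z rfl).symm

/-- A locally constant `1`-cocycle on the punctured tropical affine space is a coboundary. -/
theorem Punctured.exists_locallyConstant_primitive {A ι : Type*} [AddCommGroup A]
    (W : ι → Set (Punctured d))
    (hW : ∀ i, IsOpen (W i)) (hcov : ∀ x, ∃ i, x ∈ W i) (g : ι → ι → Punctured d → A)
    (hg : ∀ i j, ∀ x ∈ W i, x ∈ W j → ∀ᶠ y in 𝓝 x, g i j y = g i j x)
    (hc : ∀ i j k x, x ∈ W i → x ∈ W j → x ∈ W k → g i j x + g j k x = g i k x) :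
    ∃ s : ι → Punctured d → A, (∀ i, ∀ x ∈ W i, ∀ᶠ y in 𝓝 x, s i y = s i x) ∧
      ∀ i j x, x ∈ W i → x ∈ W j → g i j x = s i x - s j x := by
  obtain ⟨s, hs, hgs⟩ := TropHopf.exists_locallyConstant_primitive (fun i => ofReal ⁻¹' W i)
    (fun i => (hW i).preimage continuous_ofReal) (fun x => hcov _)
    (fun i j z => g i j (ofReal z))
    (fun i j z hi hj => continuous_ofReal.continuousAt.eventually (hg i j _ hi hj))
    (fun i j k z => hc i j k _)
  choose s' hs' he using fun i => exists_locallyConstant_extension (hW i) (s i) (hs i)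
  refine ⟨s', hs', fun i j x hi hj => ?_⟩
  -- All functions involved are constant near `x`, so the identity at `x` can be read off at a
  -- nearby finite point.
  obtain ⟨z, ⟨h1, h2⟩, ⟨h3, h4⟩, h5⟩ := exists_ofReal_of_eventually
    (((hs' i x hi).and (hs' j x hj)).and (((hW i).eventually_mem hi |>.and
      ((hW j).eventually_mem hj)).and (hg i j x hi hj)))
  rw [← h1, ← h2, ← h5, he i z h3, he j z h4, hgs i j z h3 h4]

end

/-! ### Germs of invertible regular functions -/

/-- The integer affine function with slopes `α.1` and constant term `α.2`. -/
def affine (α : (Fin d → ℤ) × ℝ) (x : Punctured d) : ℝ :=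
  α.2 + ∑ i, (α.1 i : ℝ) * coord x i

theorem affine_add (α β : (Fin d → ℤ) × ℝ) (x : Punctured d) :
    affine (α + β) x = affine α x + affine β x := by
  simp only [affine, Prod.fst_add, Prod.snd_add, Pi.add_apply, Int.cast_add, add_mul,
    Finset.sum_add_distrib]
  ring

theorem affine_neg (α : (Fin d → ℤ) × ℝ) (x : Punctured d) : affine (-α) x = -affine α x := by
  simp only [affine, Prod.fst_neg, Prod.snd_neg, Pi.neg_apply, Int.cast_neg, neg_mul,
    Finset.sum_neg_distrib]
  ring

theorem affine_sub (α β : (Fin d → ℤ) × ℝ) (x : Punctured d) :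
    affine (α - β) x = affine α x - affine β x := by
  rw [sub_eq_add_neg, affine_add, affine_neg, sub_eq_add_neg]

/-- Near `x` the function `g` is the Laurent monomial `α`, and this is invertible at `x`. -/
def HasGerm (g : Punctured d → ℝ) (x : Punctured d) (α : (Fin d → ℤ) × ℝ) : Prop :=
  (∀ i, x.1 i = ⊤ → α.1 i = 0) ∧ ∀ᶠ y in 𝓝 x, g y = affine α y

namespace HasGerm

variable {g h : Punctured d → ℝ} {x : Punctured d} {α β : (Fin d → ℤ) × ℝ}

theorem eq (hg : HasGerm g x α) : g x = affine α x := hg.2.self_of_nhds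

theorem eventually (hg : HasGerm g x α) : ∀ᶠ y in 𝓝 x, HasGerm g y α := by
  filter_upwards [eventually_ne_top x, eventually_eventually_nhds.2 hg.2] with y h1 h2
  exact ⟨fun i hi => hg.1 i (h1 i hi), h2⟩

theorem congr (hg : HasGerm g x α) (hgh : ∀ᶠ y in 𝓝 x, h y = g y) : HasGerm h x α :=
  ⟨hg.1, by filter_upwards [hg.2, hgh] with y h1 h2; rw [h2, h1]⟩

theorem add (hg : HasGerm g x α) (hh : HasGerm h x β) :
    HasGerm (fun y => g y + h y) x (α + β) :=
  ⟨fun i hi => by simp [hg.1 i hi, hh.1 i hi], by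
    filter_upwards [hg.2, hh.2] with y h1 h2
    rw [h1, h2, affine_add]⟩

theorem neg (hg : HasGerm g x α) : HasGerm (fun y => -g y) x (-α) :=
  ⟨fun i hi => by simp [hg.1 i hi], by
    filter_upwards [hg.2] with y h1
    rw [h1, affine_neg]⟩

theorem sub (hg : HasGerm g x α) (hh : HasGerm h x β) :
    HasGerm (fun y => g y - h y) x (α - β) := by
  simpa only [sub_eq_add_neg] using hg.add hh.neg

theorem const (c : ℝ) (x : Punctured d) : HasGerm (fun _ => c) x (0, c) :=
  ⟨fun _ _ => rfl, by simp [affine]⟩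

/-- Moving a single coordinate of a finite point isolates each slope. This makes germs unique, hence
locally constant in the base point. -/
theorem eq_zero [Nonempty (Fin d)] (hg : HasGerm (fun _ => 0) x α) : α = 0 := by
  obtain ⟨z, hz⟩ := exists_ofReal_of_eventually hg.eventually
  have hz' : ∀ᶠ w in 𝓝 z, 0 = affine α (ofReal w) := continuous_ofReal.continuousAt.eventually hz.2
  have h1 : ∀ i, α.1 i = 0 := by
    intro i
    have hc : Continuous fun t : ℝ => z + Pi.single i t :=
      continuous_const.add (continuous_single (A := fun _ : Fin d => ℝ) i)
    have h0 : Tendsto (fun t : ℝ => z + Pi.single i t) (𝓝 0) (𝓝 z) := by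
      simpa using hc.tendsto 0
    have h2 : ∀ᶠ t : ℝ in 𝓝[≠] 0, 0 = affine α (ofReal (z + Pi.single i t)) :=
      (h0.mono_left nhdsWithin_le_nhds).eventually hz'
    obtain ⟨t, ht, ht0⟩ := (h2.and self_mem_nhdsWithin).exists
    have h3 := hz'.self_of_nhds
    simp only [affine, coord_ofReal, Pi.add_apply, mul_add, Finset.sum_add_distrib,
      Pi.single_apply, mul_ite, mul_zero, Finset.sum_ite_eq', Finset.mem_univ, if_true] at ht h3
    have h4 : (α.1 i : ℝ) * t = 0 := by linarith
    simpa [show t ≠ 0 from ht0] using h4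
  have h2 := hz'.self_of_nhds
  simp only [affine, h1, Int.cast_zero, zero_mul, Finset.sum_const_zero, add_zero] at h2
  exact Prod.ext (funext h1) h2.symm

theorem unique [Nonempty (Fin d)] (hg : HasGerm g x α) (hh : HasGerm g x β) : α = β := by
  refine sub_eq_zero.1 (eq_zero (x := x) ((hg.sub hh).congr ?_))
  simp

end HasGerm

/-! ### Invertible regular functions on the punctured space: vanishing of H¹ and global sections -/

/-- A function on the facet `x l = ∞` that is locally constant is constant. -/
theorem exists_const_of_locallyConstant_facet [Nontrivial (Fin d)] {A : Type*} [Nonempty A]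
    (l : Fin d) (k : Punctured d → A)
    (hk : ∀ x, x.1 l = ⊤ → ∀ᶠ y in 𝓝 x, y.1 l = ⊤ → k y = k x) :
    ∃ K, ∀ x, x.1 l = ⊤ → k x = K := by
  -- A second coordinate keeps the points of `φ` inside the punctured space. The image of `φ` is
  -- connected and dense in the facet.
  obtain ⟨j, hj⟩ := exists_ne l
  let φ : (Fin d → ℝ) → Punctured d := fun z =>
    ⟨Function.update (fun i => (z i : WithTop ℝ)) l ⊤, fun h => by
      have := congrFun h j
      simp [hj] at this⟩
  have hφl : ∀ z, (φ z).1 l = ⊤ := fun z => by simp [φ]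
  have hφ : Continuous φ := by
    refine Continuous.subtype_mk (continuous_pi fun i => ?_) _
    by_cases h : i = l
    · subst h
      simpa using continuous_const
    · simp only [ne_eq, h, not_false_eq_true, Function.update_of_ne]
      exact WithTop.continuous_coe.comp (continuous_apply i)
  have hconst : IsLocallyConstant (k ∘ φ) := by
    rw [IsLocallyConstant.iff_eventually_eq]
    intro z
    filter_upwards [hφ.continuousAt.eventually (hk _ (hφl z))] with w hw
    exact hw (hφl w)
  refine ⟨k (φ 0), fun x hx => ?_⟩
  have hlim : Tendsto (fun n => φ (truncate x n)) atTop (𝓝 x) := by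
    rw [tendsto_subtype_rng, tendsto_pi_nhds]
    intro i
    by_cases h : i = l
    · subst h
      simp [φ, hx]
    · by_cases h' : x.1 i = ⊤
      · simpa [φ, truncate, h, h'] using tendsto_coe_natCast
      · simp [φ, truncate, h, h', coe_coord h']
  obtain ⟨n, hn⟩ := (hlim.eventually (hk x hx)).exists
  rw [← hn (hφl _)]
  exact hconst.apply_eq_of_preconnectedSpace _ _

/-- `H¹(𝕋ᵈ \ {∞}, 𝒪*) = 0`. -/
theorem exists_regular_primitive [Nontrivial (Fin d)] {ι : Type*} (W : ι → Set (Punctured d))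
    (hW : ∀ i, IsOpen (W i)) (hcov : ∀ x, ∃ i, x ∈ W i) (t : ι → ι → Punctured d → ℝ)
    (ht : ∀ i j, ∀ x ∈ W i, x ∈ W j → ∃ α, HasGerm (t i j) x α)
    (hc : ∀ i j k x, x ∈ W i → x ∈ W j → x ∈ W k → t i j x + t j k x = t i k x) :
    ∃ σ : ι → Punctured d → ℝ, (∀ i, ∀ x ∈ W i, ∃ α, HasGerm (σ i) x α) ∧
      ∀ i j x, x ∈ W i → x ∈ W j → t i j x = σ i x - σ j x := by
  choose! g hg using ht
  have hmem : ∀ i x, x ∈ W i → ∀ᶠ y in 𝓝 x, y ∈ W i := fun i x hx => (hW i).mem_nhds hx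
  have hgloc : ∀ i j, ∀ x ∈ W i, x ∈ W j → ∀ᶠ y in 𝓝 x, g i j y = g i j x := by
    intro i j x hi hj
    filter_upwards [(hg i j x hi hj).eventually, hmem i x hi, hmem j x hj] with y hy h1 h2
    exact (hg i j y h1 h2).unique hy
  have hgc : ∀ i j k x, x ∈ W i → x ∈ W j → x ∈ W k → g i j x + g j k x = g i k x := by
    intro i j k x hi hj hk
    refine (((hg i j x hi hj).add (hg j k x hj hk)).congr ?_).unique (hg i k x hi hk)
    filter_upwards [hmem i x hi, hmem j x hj, hmem k x hk] with y h1 h2 h3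
    exact (hc i j k y h1 h2 h3).symm
  -- The germs of `t` form a locally constant cocycle with values in ℤᵈ × ℝ. Its primitive `s` may
  -- still have nonzero slope along an infinite coordinate.
  obtain ⟨s, hs, hgs⟩ := Punctured.exists_locallyConstant_primitive W hW hcov g hgloc hgc
  choose ind hind using hcov
  have hslope : ∀ i j x l, x ∈ W i → x ∈ W j → x.1 l = ⊤ → (s i x).1 l = (s j x).1 l := by
    intro i j x l hi hj hl
    have h1 := (hg i j x hi hj).1 l hl
    rw [hgs i j x hi hj] at h1
    exact sub_eq_zero.1 h1
  -- On the facet `x l = ∞` the `l`-th slope of `s i` depends neither on `i` nor on the point.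
  -- Subtracting the single global monomial with slopes `K` makes every germ invertible and leaves
  -- the differences unchanged.
  choose K hK using fun l => exists_const_of_locallyConstant_facet l
    (fun x => (s (ind x) x).1 l) (fun x hx => by
      filter_upwards [hs (ind x) x (hind x), hmem _ x (hind x)] with y h1 h2 h3
      rw [← h1]
      exact hslope _ _ y l (hind y) h2 h3)
  refine ⟨fun i x => affine (s i x - (K, 0)) x, fun i x hx => ⟨s i x - (K, 0), ?_, ?_⟩, ?_⟩
  · intro l hl
    have h1 := hslope i (ind x) x l hx (hind x) hl
    have h2 := hK l x hl
    simp [h1, h2]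
  · filter_upwards [hs i x hx] with y hy
    rw [hy]
  · intro i j x hi hj
    rw [(hg i j x hi hj).eq, hgs i j x hi hj]
    simp only [affine_sub]
    ring

/-- Global invertible regular functions on `𝕋ᵈ \ {∞}` are constant. -/
theorem exists_const_of_regular [Nontrivial (Fin d)] (f : Punctured d → ℝ)
    (hf : ∀ x, ∃ α, HasGerm f x α) : ∃ c, ∀ x, f x = c := by
  choose g hg using hf
  have hloc : ∀ x, ∀ᶠ y in 𝓝 x, g y = g x := fun x => by
    filter_upwards [(hg x).eventually] with y hy using (hg y).unique hy
  have hconst : IsLocallyConstant (g ∘ ofReal) := by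
    rw [IsLocallyConstant.iff_eventually_eq]
    exact fun z => continuous_ofReal.continuousAt.eventually (hloc _)
  have hg0 : ∀ x, g x = g (ofReal 0) := fun x => by
    obtain ⟨z, hz⟩ := exists_ofReal_of_eventually (hloc x)
    rw [← hz]
    exact hconst.apply_eq_of_preconnectedSpace _ _
  refine ⟨(g (ofReal 0)).2, fun x => ?_⟩
  have hslope : ∀ l, (g (ofReal 0)).1 l = 0 := by
    intro l
    obtain ⟨j, hj⟩ := exists_ne l
    let y : Punctured d := ⟨Function.update (fun _ => 0) l ⊤, fun h => by
      have := congrFun h j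
      simp [hj] at this⟩
    rw [← hg0 y]
    exact (hg y).1 l (by simp [y])
  rw [(hg x).eq, hg0 x]
  simp [affine, hslope]

variable {a : Fin d → ℝ}

/-! ### The action of the translation group -/

/-- The `n`-th power of the translation `F x = x + a`. -/
def shift (a : Fin d → ℝ) (n : ℤ) (x : Punctured d) : Punctured d :=
  ⟨fun i => x.1 i + ((n * a i : ℝ) : WithTop ℝ), fun h => x.2 (funext fun i => by
    have := congrFun h i
    simpa only [WithTop.add_eq_top, WithTop.coe_ne_top, or_false] using this)⟩

theorem shift_val (n : ℤ) (x : Punctured d) (i : Fin d) :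
    (shift a n x).1 i = x.1 i + ((n * a i : ℝ) : WithTop ℝ) := rfl

@[simp] theorem shift_eq_top {n : ℤ} {x : Punctured d} {i : Fin d} :
    (shift a n x).1 i = ⊤ ↔ x.1 i = ⊤ := by
  simp only [shift_val, WithTop.add_eq_top, WithTop.coe_ne_top, or_false]

theorem IsFinite.shift {x : Punctured d} (h : IsFinite x) (n : ℤ) : IsFinite (shift a n x) :=
  fun i hi => h i (shift_eq_top.1 hi)

theorem shift_zero (x : Punctured d) : shift a 0 x = x :=
  Subtype.ext (funext fun i => by simp [shift_val])

theorem shift_shift (m n : ℤ) (x : Punctured d) : shift a m (shift a n x) = shift a (n + m) x :=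
  Subtype.ext (funext fun i => by
    rw [shift_val, shift_val, shift_val, add_assoc, ← WithTop.coe_add, Int.cast_add, add_mul])

theorem coord_shift {x : Punctured d} {i : Fin d} (h : x.1 i ≠ ⊤) (n : ℤ) :
    coord (shift a n x) i = coord x i + n * a i := by
  rw [coord, shift_val, ← coe_coord h, ← WithTop.coe_add, WithTop.untopD_coe]

theorem continuous_add_coe (r : ℝ) : Continuous fun x : WithTop ℝ => x + (r : WithTop ℝ) := by
  convert ((OrderIso.addRight r).withTopCongr).continuous using 2 with x
  induction x <;> simp [← WithTop.coe_add]

theorem continuous_shift (n : ℤ) : Continuous (shift a n) :=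
  Continuous.subtype_mk
    (continuous_pi fun i => (continuous_add_coe _).comp (continuous_val_apply i)) _

theorem proj_shift (n : ℤ) (x : Punctured d) : proj a (shift a n x) = proj a x :=
  (Quotient.sound (show (orbitSetoid a).r x (shift a n x) from ⟨n, fun _ => rfl⟩)).symm

theorem exists_shift {x y : Punctured d} (h : proj a x = proj a y) : ∃ n, y = shift a n x := by
  obtain ⟨n, hn⟩ : (orbitSetoid a).r x y := Quotient.exact h
  exact ⟨n, Subtype.ext (funext hn)⟩

theorem continuous_proj : Continuous (proj a) := continuous_quotient_mk'

theorem isQuotientMap_proj : IsQuotientMap (proj a) := isQuotientMap_quotient_mk'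

theorem isOpen_preimage (U : Opens (Hopf a)) : IsOpen (proj a ⁻¹' (U : Set (Hopf a))) :=
  U.2.preimage continuous_proj

theorem eventually_proj_mem {U : Opens (Hopf a)} {x : Punctured d} (h : proj a x ∈ U) :
    ∀ᶠ y in 𝓝 x, proj a y ∈ U :=
  (isOpen_preimage U).mem_nhds h

theorem exists_proj (p : Hopf a) : ∃ x, proj a x = p := Quotient.exists_rep p

theorem HasGerm.comp_shift {g : Punctured d → ℝ} {x : Punctured d} {n : ℤ} {α}
    (h : HasGerm g (shift a n x) α) :
    HasGerm (fun y => g (shift a n y)) x (α.1, α.2 + ∑ i, (α.1 i : ℝ) * (n * a i)) := by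
  refine ⟨fun i hi => h.1 i (shift_eq_top.2 hi), ?_⟩
  filter_upwards [(continuous_shift n).continuousAt.eventually h.2, eventually_ne_top x] with y hy ht
  rw [hy, affine, affine, add_assoc, ← Finset.sum_add_distrib]
  congr 1
  refine Finset.sum_congr rfl fun i _ => ?_
  -- An infinite coordinate has the default `coord` value `0`, which does not follow the
  -- translation, but its slope vanishes.
  by_cases hi : y.1 i = ⊤
  · simp [h.1 i (shift_eq_top.2 (ht i hi))]
  · rw [coord_shift hi]
    ring

/-- The pull-back of a function on an open subset of `S`, extended by `0`. -/
def pullback {U : Opens (Hopf a)} (f : U → ℝ) (x : Punctured d) : ℝ :=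
  open Classical in if h : proj a x ∈ U then f ⟨proj a x, h⟩ else 0

theorem pullback_apply {U : Opens (Hopf a)} (f : U → ℝ) {x : Punctured d} (h : proj a x ∈ U) :
    pullback f x = f ⟨proj a x, h⟩ := dif_pos h

theorem exists_hasGerm_pullback {U : Opens (Hopf a)} (f : OStar U) {x : Punctured d}
    (h : proj a x ∈ U) : ∃ α, HasGerm (pullback f.1) x α := by
  obtain ⟨m, c, h0, h1⟩ := f.2 x h
  refine ⟨(m, c), h0, ?_⟩
  filter_upwards [h1, eventually_proj_mem h] with y hy hU
  rw [pullback_apply _ hU, hy hU]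
  rfl

theorem eq_of_shift_invariant {U : Opens (Hopf a)} {g : Punctured d → ℝ} {c : ℝ}
    (hg : ∀ x, proj a x ∈ U → g (shift a 1 x) = g x + c) {x : Punctured d} (hx : proj a x ∈ U)
    (n : ℤ) : g (shift a n x) = g x + n * c := by
  induction n with
  | zero => simp [shift_zero]
  | succ n ih =>
    rw [← shift_shift, hg _ (by rwa [proj_shift]), ih]
    push_cast
    ring
  | pred n ih =>
    have h := hg (shift a (-n - 1) x) (by rwa [proj_shift])
    rw [shift_shift, sub_add_cancel, ih] at h
    push_cast at h ⊢
    linarith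

/-- A point of the punctured space over a point of `S`. -/
def lift (p : Hopf a) : Punctured d := (exists_proj p).choose

theorem proj_lift (p : Hopf a) : proj a (lift p) = p := (exists_proj p).choose_spec

theorem apply_eq_of_proj_eq {U : Opens (Hopf a)} {g : Punctured d → ℝ}
    (hg : ∀ x, proj a x ∈ U → g (shift a 1 x) = g x) {x y : Punctured d} (hx : proj a x ∈ U)
    (hxy : proj a x = proj a y) : g y = g x := by
  obtain ⟨n, rfl⟩ := exists_shift hxy
  rw [eq_of_shift_invariant (g := g) (c := 0) (fun x hx => by rw [hg x hx, add_zero]) hx,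
    mul_zero, add_zero]

/-- The invertible regular function on `U` given by an invariant function upstairs. -/
def descend {U : Opens (Hopf a)} (g : Punctured d → ℝ)
    (hr : ∀ x, proj a x ∈ U → ∃ α, HasGerm g x α)
    (hg : ∀ x, proj a x ∈ U → g (shift a 1 x) = g x) : OStar U :=
  ⟨fun p => g (lift p.1), fun x hx => by
    obtain ⟨α, h0, h1⟩ := hr x hx
    refine ⟨α.1, α.2, h0, ?_⟩
    filter_upwards [h1] with y hy hU
    rw [apply_eq_of_proj_eq hg hU (proj_lift _).symm, hy]
    rfl⟩

theorem descend_apply {U : Opens (Hopf a)} {g : Punctured d → ℝ}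
    (hr : ∀ x, proj a x ∈ U → ∃ α, HasGerm g x α)
    (hg : ∀ x, proj a x ∈ U → g (shift a 1 x) = g x) {x : Punctured d} (hx : proj a x ∈ U) :
    (descend g hr hg).1 ⟨proj a x, hx⟩ = g x :=
  apply_eq_of_proj_eq hg hx (proj_lift _).symm

/-! ### The degree of a cocycle -/

variable {ι : Type*} {U : ι → Opens (Hopf a)}

/-- The pull-back of the cocycle `τ` to the punctured space is the coboundary of `σ`, and `σ`
changes by the constant `c` under the translation. -/
structure IsPrimitive (τ : Cocycle U) (σ : ι → Punctured d → ℝ) (c : ℝ) : Prop where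
  regular : ∀ i x, proj a x ∈ U i → ∃ α, HasGerm (σ i) x α
  sub_eq : ∀ i j x (hi : proj a x ∈ U i) (hj : proj a x ∈ U j),
    (τ.1 i j).1 ⟨proj a x, hi, hj⟩ = σ i x - σ j x
  shift_eq : ∀ i x, proj a x ∈ U i → σ i (shift a 1 x) = σ i x + c

theorem eq_const_of_compatible [Nontrivial (Fin d)] (hU : ∀ p, ∃ i, p ∈ U i)
    {σ : ι → Punctured d → ℝ} (hσ : ∀ i x, proj a x ∈ U i → ∃ α, HasGerm (σ i) x α)
    (h : ∀ i j x, proj a x ∈ U i → proj a x ∈ U j → σ i x = σ j x) :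
    ∃ c, ∀ i x, proj a x ∈ U i → σ i x = c := by
  choose ind hind using hU
  obtain ⟨c, hc⟩ := exists_const_of_regular (fun x => σ (ind (proj a x)) x) (fun x => by
    obtain ⟨α, hα⟩ := hσ _ x (hind (proj a x))
    refine ⟨α, hα.congr ?_⟩
    filter_upwards [eventually_proj_mem (hind (proj a x))] with y hy
    exact h _ _ y (hind _) hy)
  exact ⟨c, fun i x hx => by rw [← hc x]; exact h _ _ x hx (hind _)⟩

namespace IsPrimitive

variable {τ τ' : Cocycle U} {σ σ' : ι → Punctured d → ℝ} {c c' : ℝ}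

/-- Invariance of `τ` makes `σ i ∘ F - σ i` independent of `i`; these differences glue to a global
regular function, which is constant. -/
theorem exists_of_cover [Nontrivial (Fin d)] (hU : ∀ p, ∃ i, p ∈ U i) (τ : Cocycle U) :
    ∃ σ c, IsPrimitive τ σ c := by
  obtain ⟨σ, hσ, hτ⟩ := exists_regular_primitive (fun i => proj a ⁻¹' (U i : Set (Hopf a)))
    (fun i => isOpen_preimage _) (fun x => hU _) (fun i j => pullback (τ.1 i j).1)
    (fun i j x hi hj => exists_hasGerm_pullback (τ.1 i j) (⟨hi, hj⟩ : proj a x ∈ U i ⊓ U j))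
    (fun i j k x hi hj hk => by
      rw [pullback_apply (U := U i ⊓ U j) _ ⟨hi, hj⟩, pullback_apply (U := U j ⊓ U k) _ ⟨hj, hk⟩,
        pullback_apply (U := U i ⊓ U k) _ ⟨hi, hk⟩]
      exact τ.2 i j k _ hi hj hk)
  have hτ' : ∀ i j x (hi : proj a x ∈ U i) (hj : proj a x ∈ U j),
      (τ.1 i j).1 ⟨proj a x, hi, hj⟩ = σ i x - σ j x := fun i j x hi hj => by
    rw [← hτ i j x hi hj, pullback_apply (U := U i ⊓ U j) _ ⟨hi, hj⟩]
  obtain ⟨c, hc⟩ := eq_const_of_compatible hU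
    (σ := fun i x => σ i (shift a 1 x) - σ i x) (fun i x hx => by
      obtain ⟨α, hα⟩ := hσ i (shift a 1 x) (by rwa [mem_preimage, proj_shift])
      obtain ⟨β, hβ⟩ := hσ i x hx
      exact ⟨_, hα.comp_shift.sub hβ⟩)
    (fun i j x hi hj => by
      have h1 := hτ' i j x hi hj
      have h2 := hτ' i j (shift a 1 x) (by rwa [proj_shift]) (by rwa [proj_shift])
      simp only [proj_shift] at h2
      linarith)
  exact ⟨σ, c, hσ, hτ', fun i x hx => by linarith [hc i x hx]⟩

theorem add (h : IsPrimitive τ σ c) (h' : IsPrimitive τ' σ' c') :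
    IsPrimitive (τ + τ') (fun i x => σ i x + σ' i x) (c + c') where
  regular i x hx :=
    let ⟨_, hα⟩ := h.regular i x hx
    let ⟨_, hβ⟩ := h'.regular i x hx
    ⟨_, hα.add hβ⟩
  sub_eq i j x hi hj := by
    have h1 := h.sub_eq i j x hi hj
    have h2 := h'.sub_eq i j x hi hj
    change (τ.1 i j).1 _ + (τ'.1 i j).1 _ = _
    linarith
  shift_eq i x hx := by
    rw [h.shift_eq i x hx, h'.shift_eq i x hx]
    ring

/-- Two primitives of the same cocycle differ by one global constant, which cancels in the
translation rule. -/
theorem unique [Nontrivial (Fin d)] (hU : ∀ p, ∃ i, p ∈ U i) (h : IsPrimitive τ σ c)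
    (h' : IsPrimitive τ σ' c') : c = c' := by
  obtain ⟨k, hk⟩ := eq_const_of_compatible hU (σ := fun i x => σ i x - σ' i x)
    (fun i x hx =>
      let ⟨_, hα⟩ := h.regular i x hx
      let ⟨_, hβ⟩ := h'.regular i x hx
      ⟨_, hα.sub hβ⟩)
    (fun i j x hi hj => by
      have h1 := h.sub_eq i j x hi hj
      have h2 := h'.sub_eq i j x hi hj
      linarith)
  obtain ⟨i, hi⟩ := hU (proj a (ofReal 0))
  have h1 := hk i _ hi
  have h2 := hk i (shift a 1 (ofReal 0)) (by rwa [proj_shift])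
  rw [h.shift_eq i _ hi, h'.shift_eq i _ hi] at h2
  linarith

theorem coboundary (σ : ∀ i, OStar (U i)) :
    IsPrimitive (TropHopf.coboundary U σ) (fun i => pullback (σ i).1) 0 where
  regular i _ hx := exists_hasGerm_pullback (σ i) hx
  sub_eq i j x hi hj := by
    rw [pullback_apply _ hi, pullback_apply _ hj]
    rfl
  shift_eq i x hx := by
    rw [pullback_apply _ hx, pullback_apply _ (by rwa [proj_shift])]
    simp only [proj_shift, add_zero]

theorem mem_range_coboundary (h : IsPrimitive τ σ 0) : τ ∈ (TropHopf.coboundary U).range := by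
  have hs : ∀ i x, proj a x ∈ U i → σ i (shift a 1 x) = σ i x := fun i x hx => by
    rw [h.shift_eq i x hx, add_zero]
  refine ⟨fun i => descend (σ i) (h.regular i) (hs i), ?_⟩
  apply Subtype.ext
  funext i j
  apply Subtype.ext
  funext ⟨p, hi, hj⟩
  obtain ⟨x, rfl⟩ := exists_proj p
  rw [h.sub_eq i j x hi hj, ← descend_apply (h.regular i) (hs i) hi,
    ← descend_apply (h.regular j) (hs j) hj]
  rfl

theorem refine {κ : Type*} {V : κ → Opens (Hopf a)} (h : IsPrimitive τ σ c) (φ : κ → ι)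
    (hV : ∀ k, V k ≤ U (φ k)) : IsPrimitive (Cocycle.refine φ hV τ) (fun k => σ (φ k)) c where
  regular k x hx := h.regular _ x (hV k hx)
  sub_eq k l x hk hl := h.sub_eq _ _ x (hV k hk) (hV l hl)
  shift_eq k x hx := h.shift_eq _ x (hV k hx)

end IsPrimitive

/-- The translation constant of a primitive, as a homomorphism on cocycles. -/
def degree [Nontrivial (Fin d)] (hU : ∀ p, ∃ i, p ∈ U i) : Cocycle U →+ ℝ :=
  AddMonoidHom.mk' (fun τ => (IsPrimitive.exists_of_cover hU τ).choose_spec.choose) fun τ τ' =>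
    (IsPrimitive.exists_of_cover hU (τ + τ')).choose_spec.choose_spec.unique hU
      ((IsPrimitive.exists_of_cover hU τ).choose_spec.choose_spec.add
        (IsPrimitive.exists_of_cover hU τ').choose_spec.choose_spec)

theorem IsPrimitive.degree_eq [Nontrivial (Fin d)] (hU : ∀ p, ∃ i, p ∈ U i) {τ : Cocycle U}
    {σ : ι → Punctured d → ℝ} {c : ℝ} (h : IsPrimitive τ σ c) : degree hU τ = c :=
  (IsPrimitive.exists_of_cover hU τ).choose_spec.choose_spec.unique hU h

/-- The degree on the Čech cohomology of a cover. -/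
def CechH1.degree [Nontrivial (Fin d)] (hU : ∀ p, ∃ i, p ∈ U i) : CechH1 U →+ ℝ :=
  QuotientAddGroup.lift _ (TropHopf.degree hU) (by
    rintro _ ⟨σ, rfl⟩
    exact (IsPrimitive.coboundary σ).degree_eq hU)

theorem CechH1.degree_injective [Nontrivial (Fin d)] (hU : ∀ p, ∃ i, p ∈ U i) :
    Function.Injective (CechH1.degree hU) := by
  rw [injective_iff_map_eq_zero]
  intro x hx
  obtain ⟨τ, rfl⟩ := QuotientAddGroup.mk_surjective x
  obtain ⟨σ, c, h⟩ := IsPrimitive.exists_of_cover hU τ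
  obtain rfl : c = 0 := (h.degree_eq hU).symm.trans hx
  exact (QuotientAddGroup.eq_zero_iff τ).2 h.mem_range_coboundary

theorem CechH1.degree_refine [Nontrivial (Fin d)] (hU : ∀ p, ∃ i, p ∈ U i) {κ : Type*}
    {V : κ → Opens (Hopf a)} (hV : ∀ p, ∃ k, p ∈ V k) (φ : κ → ι) (h : ∀ k, V k ≤ U (φ k))
    (x : CechH1 U) : CechH1.degree hV (CechH1.refine φ h x) = CechH1.degree hU x := by
  obtain ⟨τ, rfl⟩ := QuotientAddGroup.mk_surjective x
  obtain ⟨σ, c, hσ⟩ := IsPrimitive.exists_of_cover hU τ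
  exact ((hσ.refine φ h).degree_eq hV).trans (hσ.degree_eq hU).symm

/-! ### Passage to the direct limit over covers -/

instance : Nonempty (PointedCover a)ᵒᵈ := ⟨OrderDual.toDual ⟨fun _ => ⊤, fun _ => trivial⟩⟩

instance : IsDirectedOrder (PointedCover a)ᵒᵈ where
  directed U V :=
    ⟨OrderDual.toDual ⟨fun p => (OrderDual.ofDual U).1 p ⊓ (OrderDual.ofDual V).1 p,
      fun p => ⟨(OrderDual.ofDual U).2 p, (OrderDual.ofDual V).2 p⟩⟩,
      fun _ => inf_le_left, fun _ => inf_le_right⟩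

theorem Pic.exists_mk (c : Pic a) : ∃ U τ, Pic.mk U τ = c := by
  induction c using AddCommGroup.DirectLimit.induction_on with
  | ih U x =>
    obtain ⟨τ, rfl⟩ := QuotientAddGroup.mk_surjective x
    exact ⟨OrderDual.ofDual U, τ, rfl⟩

/-- The degree homomorphism `Pic(S) → ℝ`. -/
def Pic.degree [Nontrivial (Fin d)] : Pic a →+ ℝ :=
  AddCommGroup.DirectLimit.lift _ _ ℝ
    (fun U => CechH1.degree fun p => ⟨p, (OrderDual.ofDual U).2 p⟩)
    (fun _ _ _ x => CechH1.degree_refine _ _ _ _ x)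

theorem Pic.degree_mk [Nontrivial (Fin d)] (U : PointedCover a) (τ : Cocycle U.1) :
    Pic.degree (Pic.mk U τ) = TropHopf.degree (fun p => ⟨p, U.2 p⟩) τ :=
  AddCommGroup.DirectLimit.lift_of _ _ _ _ _

theorem Pic.degree_injective [Nontrivial (Fin d)] : Function.Injective (Pic.degree (a := a)) :=
  AddCommGroup.DirectLimit.lift_injective _ _ _ fun _ => CechH1.degree_injective _

/-! ### Surjectivity of the degree -/

theorem exists_time [Nonempty (Fin d)] (ha : ∀ i, 0 < a i) (x : Punctured d) :
    ∃ t : ℝ, ∀ r : ℝ, r ≤ t ↔ ∀ i, ((r * a i : ℝ) : WithTop ℝ) ≤ x.1 i := by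
  classical
  have hne : (Finset.univ.filter fun i => x.1 i ≠ ⊤).Nonempty := by
    by_contra h
    refine x.2 (funext fun i => ?_)
    by_contra hi
    exact h ⟨i, by simpa using hi⟩
  -- Infinite coordinates impose no condition on `r`, so the minimum runs over the finite ones, of
  -- which there is at least one.
  refine ⟨(Finset.univ.filter fun i => x.1 i ≠ ⊤).inf' hne fun i => coord x i / a i, fun r => ?_⟩
  rw [Finset.le_inf'_iff]
  refine forall_congr' fun i => ?_
  by_cases hi : x.1 i = ⊤
  · simp [hi]
  · rw [← coe_coord hi, WithTop.coe_le_coe, ← le_div_iff₀ (ha i)]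
    simp [hi]

/-- The function `min (x i / a i)`, which increases by `1` under the translation by `a`. -/
def time [Nonempty (Fin d)] (ha : ∀ i, 0 < a i) (x : Punctured d) : ℝ := (exists_time ha x).choose

section

variable [Nonempty (Fin d)] (ha : ∀ i, 0 < a i)

theorem le_time_iff {x : Punctured d} {r : ℝ} :
    r ≤ time ha x ↔ ∀ i, ((r * a i : ℝ) : WithTop ℝ) ≤ x.1 i :=
  (exists_time ha x).choose_spec r

theorem time_lt_iff {x : Punctured d} {r : ℝ} :
    time ha x < r ↔ ∃ i, x.1 i < ((r * a i : ℝ) : WithTop ℝ) := by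
  rw [← not_le, le_time_iff]
  push Not
  rfl

theorem time_shift (n : ℤ) (x : Punctured d) : time ha (shift a n x) = time ha x + n := by
  refine eq_of_forall_le_iff fun r => ?_
  rw [le_time_iff, ← sub_le_iff_le_add, le_time_iff]
  refine forall_congr' fun i => ?_
  rw [shift_val]
  by_cases hi : x.1 i = ⊤
  · simp [hi]
  · rw [← coe_coord hi, ← WithTop.coe_add, WithTop.coe_le_coe, WithTop.coe_le_coe, sub_mul,
      sub_le_iff_le_add]

theorem eventually_time_lt {x : Punctured d} {r : ℝ} (h : time ha x < r) :
    ∀ᶠ y in 𝓝 x, time ha y < r := by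
  obtain ⟨i, hi⟩ := (time_lt_iff ha).1 h
  filter_upwards [(continuous_val_apply i).continuousAt.eventually (isOpen_Iio.mem_nhds hi)]
    with y hy using (time_lt_iff ha).2 ⟨i, hy⟩

theorem eventually_lt_time {x : Punctured d} {r : ℝ} (h : r < time ha x) :
    ∀ᶠ y in 𝓝 x, r < time ha y := by
  obtain ⟨s, hrs, hs⟩ := exists_between h
  have h1 : ∀ᶠ y in 𝓝 x, ∀ i, ((s * a i : ℝ) : WithTop ℝ) < y.1 i := by
    rw [eventually_all]
    intro i
    have h2 : ((s * a i : ℝ) : WithTop ℝ) < x.1 i := lt_of_lt_of_le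
      (WithTop.coe_lt_coe.2 (mul_lt_mul_of_pos_right hs (ha i))) ((le_time_iff ha).1 le_rfl i)
    exact (continuous_val_apply i).continuousAt.eventually (isOpen_Ioi.mem_nhds h2)
  filter_upwards [h1] with y hy using hrs.trans_le ((le_time_iff ha).2 fun i => (hy i).le)

theorem eventually_floor_time_eq {θ : ℝ} {x : Punctured d} (h : Int.fract (time ha x - θ) ≠ 0) :
    ∀ᶠ y in 𝓝 x, Int.fract (time ha y - θ) ≠ 0 ∧ ⌊time ha y - θ⌋ = ⌊time ha x - θ⌋ := by
  have h1 : ⌊time ha x - θ⌋ + θ < time ha x := by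
    have := lt_of_le_of_ne (Int.fract_nonneg _) h.symm
    rw [Int.fract] at this
    linarith
  have h2 : time ha x < ⌊time ha x - θ⌋ + 1 + θ := by linarith [Int.lt_floor_add_one (time ha x - θ)]
  filter_upwards [eventually_lt_time ha h1, eventually_time_lt ha h2] with y hy1 hy2
  have h3 : ⌊time ha y - θ⌋ = ⌊time ha x - θ⌋ :=
    Int.floor_eq_iff.2 ⟨by linarith, by linarith⟩
  refine ⟨?_, h3⟩
  rw [Int.fract, h3]
  exact ne_of_gt (by linarith)

/-- The open subset of `S` where the class of `time` modulo `1` is not that of `θ`. -/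
def timeOpen (θ : ℝ) : Opens (Hopf a) where
  carrier := {p | Int.fract (time ha (lift p) - θ) ≠ 0}
  is_open' := by
    rw [← isQuotientMap_proj.isOpen_preimage]
    have : proj a ⁻¹' {p | Int.fract (time ha (lift p) - θ) ≠ 0} =
        {x | Int.fract (time ha x - θ) ≠ 0} := by
      ext x
      obtain ⟨n, hn⟩ := exists_shift (proj_lift (proj a x)).symm
      change Int.fract (time ha (lift (proj a x)) - θ) ≠ 0 ↔ _
      rw [hn, time_shift, add_sub_right_comm, Int.fract_add_intCast]
      rfl
    rw [this, isOpen_iff_mem_nhds]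
    intro x hx
    filter_upwards [eventually_floor_time_eq ha hx] with y hy using hy.1

theorem proj_mem_timeOpen {θ : ℝ} {x : Punctured d} :
    proj a x ∈ timeOpen ha θ ↔ Int.fract (time ha x - θ) ≠ 0 := by
  obtain ⟨n, hn⟩ := exists_shift (proj_lift (proj a x)).symm
  change Int.fract (time ha (lift (proj a x)) - θ) ≠ 0 ↔ _
  rw [hn, time_shift, add_sub_right_comm, Int.fract_add_intCast]

end

/-- The constant `c` cancels in `σ i - σ j`, which is therefore invariant and descends to `S`. -/
theorem IsPrimitive.exists_of_shift_eq {σ : ι → Punctured d → ℝ} {c : ℝ}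
    (hr : ∀ i x, proj a x ∈ U i → ∃ α, HasGerm (σ i) x α)
    (hs : ∀ i x, proj a x ∈ U i → σ i (shift a 1 x) = σ i x + c) :
    ∃ τ : Cocycle U, IsPrimitive τ σ c := by
  have hr' : ∀ i j x, proj a x ∈ U i ⊓ U j → ∃ α, HasGerm (fun y => σ i y - σ j y) x α :=
    fun i j x hx =>
      let ⟨_, hα⟩ := hr i x hx.1
      let ⟨_, hβ⟩ := hr j x hx.2
      ⟨_, hα.sub hβ⟩
  have hs' : ∀ i j x, proj a x ∈ U i ⊓ U j →
      (fun y => σ i y - σ j y) (shift a 1 x) = (fun y => σ i y - σ j y) x := fun i j x hx => by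
    simp only
    rw [hs i x hx.1, hs j x hx.2]
    ring
  have key : ∀ i j x (hi : proj a x ∈ U i) (hj : proj a x ∈ U j),
      (descend _ (hr' i j) (hs' i j)).1 ⟨proj a x, hi, hj⟩ = σ i x - σ j x :=
    fun i j x hi hj => descend_apply (hr' i j) (hs' i j) (⟨hi, hj⟩ : proj a x ∈ U i ⊓ U j)
  refine ⟨⟨fun i j => descend _ (hr' i j) (hs' i j), ?_⟩, hr, key, hs⟩
  intro i j k p hi hj hk
  obtain ⟨x, rfl⟩ := exists_proj p
  exact (congrArg₂ (· + ·) (key i j x hi hj) (key j k x hj hk)).trans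
    ((sub_add_sub_cancel _ _ _).trans (key i k x hi hk).symm)

theorem Pic.degree_surjective [Nontrivial (Fin d)] (ha : ∀ i, 0 < a i) :
    Function.Surjective (Pic.degree (a := a)) := by
  intro c
  -- The offset `1 / 2` puts `p` halfway between consecutive jumps of the floor used as primitive.
  let θ : Hopf a → ℝ := fun p => time ha (lift p) + 1 / 2
  have hmem : ∀ p, p ∈ timeOpen ha (θ p) := fun p => by
    have h : proj a (lift p) ∈ timeOpen ha (θ p) := by
      rw [proj_mem_timeOpen, sub_add_cancel_left, ne_eq, Int.fract_neg_eq_zero]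
      norm_num [Int.fract]
    rwa [proj_lift] at h
  obtain ⟨τ, hτ⟩ := IsPrimitive.exists_of_shift_eq (U := fun p => timeOpen ha (θ p))
    (σ := fun p x => ⌊time ha x - θ p⌋ * c) (c := c)
    (fun p x hx => ⟨_, (HasGerm.const (⌊time ha x - θ p⌋ * c) x).congr (by
      filter_upwards [eventually_floor_time_eq ha ((proj_mem_timeOpen ha).1 hx)] with y hy
      rw [hy.2])⟩)
    (fun p x _ => by
      rw [time_shift, add_sub_right_comm, Int.floor_add_intCast]
      push_cast
      ring)
  refine ⟨Pic.mk ⟨_, hmem⟩ τ, ?_⟩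
  rw [Pic.degree_mk]
  exact hτ.degree_eq _

theorem Pic.nonempty_equiv_real [Nontrivial (Fin d)] (ha : ∀ i, 0 < a i) :
    Nonempty (Pic a ≃+ ℝ) :=
  ⟨AddEquiv.ofBijective Pic.degree ⟨Pic.degree_injective, Pic.degree_surjective ha⟩⟩

/-! ### Tropical polynomials -/

theorem coe_inf'_univ [Nonempty (Fin d)] (f : Fin d → ℝ) :
    ((Finset.univ.inf' Finset.univ_nonempty f : ℝ) : WithTop ℝ) =
      Finset.univ.inf fun i => (f i : WithTop ℝ) := by
  rw [Finset.coe_inf']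
  rfl

namespace TropPoly

/-- The product of a tropical polynomial and the monomial with exponent `k` and coefficient `c`. -/
def mulMonomial (P : TropPoly d) (k : Fin d → ℕ) (c : ℝ) : TropPoly d where
  exps := P.exps.image (· + k)
  nonempty := P.nonempty.image _
  coeff I := P.coeff (I - k) + c

theorem eval_mulMonomial (P : TropPoly d) (k : Fin d → ℕ) (c : ℝ) (x : Fin d → WithTop ℝ) :
    (P.mulMonomial k c).eval x = P.eval x + ((c : WithTop ℝ) + ∑ i, k i • x i) := by
  have h := Finset.apply_inf_eq_inf_comp_of_linearOrder (s := P.exps)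
    (f := fun I => (P.coeff I : WithTop ℝ) + ∑ i, I i • x i)
    (fun z : WithTop ℝ => z + ((c : WithTop ℝ) + ∑ i, k i • x i))
    (fun _ _ h => add_le_add_left h _) (top_add _)
  rw [eval, eval, h, mulMonomial, Finset.inf_image]
  refine Finset.inf_congr rfl fun I _ => ?_
  simp only [Function.comp_apply, add_tsub_cancel_right, Pi.add_apply, add_smul,
    Finset.sum_add_distrib, WithTop.coe_add]
  abel

/-- The tropical polynomial `min (c, b i + N x i)`. -/
def minLinear (N : ℕ) (b : Fin d → ℝ) (c : ℝ) : TropPoly d where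
  exps := insert 0 (Finset.univ.image fun i => Pi.single i N)
  nonempty := Finset.insert_nonempty _ _
  -- For `I = Pi.single i N` with `N ≠ 0` the sum has `b i` as its only possibly nonzero term.
  coeff I := if I = 0 then c else ∑ i, if I i = 0 then 0 else b i

theorem eval_minLinear [Nonempty (Fin d)] {N : ℕ} (hN : N ≠ 0) (b : Fin d → ℝ) (c : ℝ)
    {x : Punctured d} (hx : IsFinite x) :
    (minLinear N b c).eval x.1 = ((min c (Finset.univ.inf' Finset.univ_nonempty fun i =>
      b i + N * coord x i) : ℝ) : WithTop ℝ) := by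
  rw [WithTop.coe_min, coe_inf'_univ, eval, minLinear, Finset.inf_insert, Finset.inf_image]
  congr 1
  · simp
  · refine Finset.inf_congr rfl fun i _ => ?_
    have h0 : (Pi.single i N : Fin d → ℕ) ≠ 0 := by simpa using hN
    have h1 : ∀ j, (Pi.single i N : Fin d → ℕ) j = 0 ↔ j ≠ i := fun j => by
      by_cases h : j = i
      · subst h
        simpa using hN
      · simp [h]
    have h2 : ∑ j, (Pi.single i N : Fin d → ℕ) j • x.1 j = N • x.1 i := by
      rw [Finset.sum_eq_single i (fun j _ hj => by simp [hj]) (by simp), Pi.single_eq_same]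
    simp only [Function.comp_apply, h0, if_false, h1, ite_not, Finset.sum_ite_eq',
      Finset.mem_univ, if_true, h2]
    rw [WithTop.coe_add, ← coe_coord (hx i), ← WithTop.coe_nsmul, nsmul_eq_mul]

end TropPoly

/-! ### Rational functions on the punctured space -/

/-- Near `x` the function `f` is, at finite points, a difference of tropical polynomials. -/
def IsRationalAt (f : Punctured d → ℝ) (x : Punctured d) : Prop :=
  ∃ P Q : TropPoly d, ∀ᶠ y in 𝓝 x, IsFinite y → (f y : WithTop ℝ) + Q.eval y.1 = P.eval y.1

theorem IsRationalAt.neg {f : Punctured d → ℝ} {x : Punctured d} (h : IsRationalAt f x) :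
    IsRationalAt (fun y => -f y) x := by
  obtain ⟨P, Q, h⟩ := h
  refine ⟨Q, P, ?_⟩
  filter_upwards [h] with y hy hf
  rw [← hy hf, ← add_assoc, ← WithTop.coe_add, neg_add_cancel, WithTop.coe_zero, zero_add]

theorem coe_add_sum_nsmul {y : Punctured d} (hy : IsFinite y) (k : Fin d → ℕ) (c : ℝ) :
    (c : WithTop ℝ) + ∑ i, k i • y.1 i = ((c + ∑ i, (k i : ℝ) * coord y i : ℝ) : WithTop ℝ) := by
  rw [WithTop.coe_add, WithTop.coe_sum]
  congr 1
  refine Finset.sum_congr rfl fun i _ => ?_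
  rw [← coe_coord (hy i), ← WithTop.coe_nsmul, nsmul_eq_mul]

/-- The positive parts of the slopes are moved into `P` and the negative parts into `Q`, so that all
exponents are natural numbers. -/
theorem HasGerm.add_isRationalAt {g f : Punctured d → ℝ} {x : Punctured d} {α}
    (hg : HasGerm g x α) (hf : IsRationalAt f x) : IsRationalAt (fun y => g y + f y) x := by
  obtain ⟨P, Q, h⟩ := hf
  refine ⟨P.mulMonomial (fun i => (α.1 i).toNat) α.2, Q.mulMonomial (fun i => (-α.1 i).toNat) 0, ?_⟩
  filter_upwards [h, hg.2] with y hy hgy hfin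
  have key : g y + (0 + ∑ i, ((-α.1 i).toNat : ℝ) * coord y i) =
      α.2 + ∑ i, ((α.1 i).toNat : ℝ) * coord y i := by
    rw [hgy, affine, zero_add, add_assoc, ← Finset.sum_add_distrib]
    congr 1
    refine Finset.sum_congr rfl fun i _ => ?_
    have h1 : ((α.1 i : ℤ) : ℝ) = ((α.1 i).toNat : ℝ) - ((-α.1 i).toNat : ℝ) := by
      exact_mod_cast (Int.toNat_sub_toNat_neg (α.1 i)).symm
    rw [h1]
    ring
  rw [TropPoly.eval_mulMonomial, TropPoly.eval_mulMonomial, coe_add_sum_nsmul hfin,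
    coe_add_sum_nsmul hfin, ← hy hfin, ← key, WithTop.coe_add (g y), WithTop.coe_add (g y)]
  abel

/-! ### A tropical rational function with prescribed translation constant -/

section

variable [Nonempty (Fin d)]

/-- The minimum of `N (x i - n a i)` over the finite coordinates, and of `0` if there are infinite
coordinates. -/
def level (a : Fin d → ℝ) (N : ℕ) (n : ℤ) (x : Punctured d) : ℝ :=
  open Classical in Finset.univ.inf' Finset.univ_nonempty fun i =>
    if x.1 i = ⊤ then 0 else N * (coord x i - n * a i)

theorem level_shift (N : ℕ) (n : ℤ) (x : Punctured d) :
    level a N (n + 1) (shift a 1 x) = level a N n x := by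
  rw [level, level]
  congr 1
  funext i
  by_cases h : x.1 i = ⊤
  · simp [h]
  · simp only [shift_eq_top, h, if_false, coord_shift h]
    push_cast
    ring

theorem level_of_isFinite {N : ℕ} {n : ℤ} {x : Punctured d} (hx : IsFinite x) :
    level a N n x = Finset.univ.inf' Finset.univ_nonempty fun i =>
      -(N * (n * a i)) + N * coord x i := by
  rw [level]
  congr 1
  funext i
  rw [if_neg (hx i)]
  ring

/-- A function on the punctured space which increases by `c` under the translation by `a`. -/
def quasiPeriodic (ha : ∀ i, 0 < a i) (N : ℕ) (c : ℝ) (x : Punctured d) : ℝ :=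
  ⌊time ha x⌋ * c + min c (level a N ⌊time ha x⌋ x)

theorem quasiPeriodic_shift (ha : ∀ i, 0 < a i) (N : ℕ) (c : ℝ) (x : Punctured d) :
    quasiPeriodic ha N c (shift a 1 x) = quasiPeriodic ha N c x + c := by
  rw [quasiPeriodic, quasiPeriodic, time_shift, Int.floor_add_intCast, level_shift]
  push_cast
  ring

/-- One formula valid across the jump of the floor at `time = n`, which exhibits a difference of
tropical polynomials. For `time ≥ n` the level is nonnegative and `min 0` vanishes. For `n - 1/2 <
time < n` the two minima coincide and cancel, while `2 * c ≤ N * a i` forces the previous level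
above `c`, so the function already equals `n * c`. -/
theorem quasiPeriodic_eq (ha : ∀ i, 0 < a i) {N : ℕ} {c : ℝ} (hc : 0 ≤ c)
    (hN : ∀ i, 2 * c ≤ N * a i) {n : ℤ} {y : Punctured d} (hy : IsFinite y)
    (h1 : (n : ℝ) - 1 / 2 < time ha y) (h2 : time ha y < n + 1) :
    quasiPeriodic ha N c y + min 0 (level a N n y) = min c (level a N n y) + n * c := by
  by_cases hn : n ≤ time ha y
  · have hfl : ⌊time ha y⌋ = n := Int.floor_eq_iff.2 ⟨hn, h2⟩
    have hv : 0 ≤ level a N n y := by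
      rw [level, Finset.le_inf'_iff]
      intro i _
      rw [if_neg (hy i)]
      have := (le_time_iff ha).1 hn i
      rw [← coe_coord (hy i), WithTop.coe_le_coe] at this
      exact mul_nonneg (Nat.cast_nonneg _) (sub_nonneg.2 this)
    rw [quasiPeriodic, hfl, min_eq_left hv]
    ring
  · rw [not_le] at hn
    have hfl : ⌊time ha y⌋ = n - 1 := Int.floor_eq_iff.2
      ⟨by push_cast; linarith, by push_cast; linarith⟩
    have hv : c ≤ level a N (n - 1) y := by
      rw [level, Finset.le_inf'_iff]
      intro i _
      rw [if_neg (hy i)]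
      have h3 := (le_time_iff ha).1 h1.le i
      rw [← coe_coord (hy i), WithTop.coe_le_coe] at h3
      have h4 : a i / 2 ≤ coord y i - ((n - 1 : ℤ) : ℝ) * a i := by
        push_cast
        linarith
      have h5 := mul_le_mul_of_nonneg_left h4 (Nat.cast_nonneg (α := ℝ) N)
      linarith [hN i]
    have hv' : level a N n y ≤ 0 := by
      obtain ⟨i, hi⟩ := (time_lt_iff ha).1 hn
      rw [← coe_coord (hy i), WithTop.coe_lt_coe] at hi
      refine (Finset.inf'_le _ (Finset.mem_univ i)).trans ?_
      rw [if_neg (hy i)]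
      exact mul_nonpos_of_nonneg_of_nonpos (Nat.cast_nonneg _) (sub_nonpos.2 hi.le)
    rw [quasiPeriodic, hfl, min_eq_left hv, min_eq_right hv', min_eq_right (hv'.trans hc)]
    push_cast
    ring

theorem isRationalAt_quasiPeriodic (ha : ∀ i, 0 < a i) {N : ℕ} (hN0 : N ≠ 0) {c : ℝ} (hc : 0 ≤ c)
    (hN : ∀ i, 2 * c ≤ N * a i) (x : Punctured d) :
    IsRationalAt (quasiPeriodic ha N c) x := by
  set n := ⌊time ha x⌋
  refine ⟨(TropPoly.minLinear N (fun i => -(N * (n * a i))) c).mulMonomial 0 (n * c),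
    TropPoly.minLinear N (fun i => -(N * (n * a i))) 0, ?_⟩
  have h1 : (n : ℝ) - 1 / 2 < time ha x := by linarith [Int.floor_le (time ha x)]
  filter_upwards [eventually_lt_time ha h1, eventually_time_lt ha (Int.lt_floor_add_one (time ha x))]
    with y hy1 hy2 hy
  rw [TropPoly.eval_mulMonomial, TropPoly.eval_minLinear hN0 _ _ hy,
    TropPoly.eval_minLinear hN0 _ _ hy, ← level_of_isFinite hy, ← WithTop.coe_add,
    quasiPeriodic_eq ha hc hN hy hy1 hy2]
  simp only [Pi.zero_apply, zero_smul, Finset.sum_const_zero, add_zero, WithTop.coe_add]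

theorem exists_quasiPeriodic (ha : ∀ i, 0 < a i) (c : ℝ) :
    ∃ f : Punctured d → ℝ, (∀ x, f (shift a 1 x) = f x + c) ∧ ∀ x, IsRationalAt f x := by
  -- Negation exchanges numerator and denominator, which reduces the case `c < 0` to positive
  -- constants.
  wlog hc : 0 ≤ c generalizing c
  · obtain ⟨f, h1, h2⟩ := this (-c) (by linarith)
    exact ⟨fun x => -f x, fun x => by simp only [h1]; ring, fun x => (h2 x).neg⟩
  obtain ⟨N, hN⟩ : ∃ N : ℕ, ∀ i, 2 * c / a i ≤ N := by
    refine ⟨⌈Finset.univ.sup' Finset.univ_nonempty fun i => 2 * c / a i⌉₊, fun i => ?_⟩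
    exact (Finset.le_sup' (fun i => 2 * c / a i) (Finset.mem_univ i)).trans (Nat.le_ceil _)
  refine ⟨quasiPeriodic ha (N + 1) c, quasiPeriodic_shift ha _ c,
    isRationalAt_quasiPeriodic ha N.succ_ne_zero hc fun i => ?_⟩
  have := (div_le_iff₀ (ha i)).1 (hN i)
  push_cast
  linarith [ha i]

end

/-! ### Sections -/

/-- The rational function on `U` given by an invariant rational function upstairs. -/
def RatFun.descend {U : Opens (Hopf a)} (g : Punctured d → ℝ)
    (hr : ∀ x, proj a x ∈ U → IsRationalAt g x)
    (hg : ∀ x, proj a x ∈ U → g (shift a 1 x) = g x) : RatFun U where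
  toFun p := g (lift p.1)
  isRational x hx := by
    obtain ⟨P, Q, h⟩ := hr x hx
    refine ⟨P, Q, ?_⟩
    filter_upwards [h] with y hy hU hf
    rw [← hy hf]
    exact congrArg (fun r : ℝ => (r : WithTop ℝ) + Q.eval y.1)
      (apply_eq_of_proj_eq hg hU (proj_lift _).symm)

theorem RatFun.descend_apply {U : Opens (Hopf a)} {g : Punctured d → ℝ}
    (hr : ∀ x, proj a x ∈ U → IsRationalAt g x)
    (hg : ∀ x, proj a x ∈ U → g (shift a 1 x) = g x) {x : Punctured d} (hx : proj a x ∈ U)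
    (hf : IsFinite x) : (RatFun.descend g hr hg).toFun (finitePoint x hx hf) = g x :=
  apply_eq_of_proj_eq hg hx (proj_lift _).symm

theorem exists_isSectionOf [Nontrivial (Fin d)] (ha : ∀ i, 0 < a i) (hU : ∀ p, ∃ i, p ∈ U i)
    (τ : Cocycle U) : ∃ f : ∀ i, RatFun (U i), IsSectionOf τ f := by
  obtain ⟨σ, c, hσ⟩ := IsPrimitive.exists_of_cover hU τ
  -- The constant `-c` compensates that of `σ`, so `σ i + h` is invariant, and `h` cancels in
  -- differences.
  obtain ⟨h, hs, hr⟩ := exists_quasiPeriodic ha (-c)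
  refine ⟨fun i => RatFun.descend (fun x => σ i x + h x)
    (fun x hx => (hσ.regular i x hx).choose_spec.add_isRationalAt (hr x))
    (fun x hx => by rw [hσ.shift_eq i x hx, hs]; ring), fun i j y hi hj hf => ?_⟩
  rw [RatFun.descend_apply, RatFun.descend_apply, hσ.sub_eq i j y hi hj]
  ring

/-! ### Divisors -/

theorem RatFun.toFun_eq {U : Opens (Hopf a)} (f : RatFun U) {x y : Punctured d}
    (h : proj a x = proj a y) (hx : proj a x ∈ U) (hy : proj a y ∈ U) (hfx : IsFinite x)
    (hfy : IsFinite y) : f.toFun (finitePoint x hx hfx) = f.toFun (finitePoint y hy hfy) :=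
  congrArg f.toFun (Subtype.ext h)

/-- Translating by a multiple of `a` changes only the constant term of the local expression. -/
theorem RatFun.HasMult.shift {U : Opens (Hopf a)} {f : RatFun U} {x : Punctured d} {w : ℤ}
    (h : f.HasMult x w) (k : ℤ) : f.HasMult (shift a k x) w := by
  have hlim : Tendsto (TropHopf.shift a (-k)) (𝓝 (TropHopf.shift a k x)) (𝓝 x) := by
    have := (continuous_shift (a := a) (-k)).tendsto (TropHopf.shift a k x)
    rwa [shift_shift, add_neg_cancel, shift_zero] at this
  have hf : ∀ (y : Punctured d) (hy : proj a y ∈ U) (hfin : IsFinite y),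
      f.toFun (finitePoint y hy hfin) = f.toFun (finitePoint (TropHopf.shift a (-k) y)
        (by rwa [proj_shift]) (hfin.shift _)) := fun y hy hfin =>
    f.toFun_eq (proj_shift _ _).symm _ _ _ _
  have hsum : ∀ (m : Fin d → ℤ) (y : Punctured d), IsFinite y →
      ∑ j, (m j : ℝ) * coord (TropHopf.shift a (-k) y) j =
        -(∑ j, (m j : ℝ) * (k * a j)) + ∑ j, (m j : ℝ) * coord y j := fun m y hy => by
    rw [← Finset.sum_neg_distrib, ← Finset.sum_add_distrib]
    refine Finset.sum_congr rfl fun j _ => ?_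
    rw [coord_shift (hy j)]
    push_cast
    ring
  rcases h with ⟨hx, n, m, c, hn, h⟩ | ⟨i, hi, m, c, hm, h⟩
  · refine Or.inl ⟨hx.shift k, n, m, c - ∑ j, (m j : ℝ) * (k * a j), hn, ?_⟩
    filter_upwards [hlim.eventually h] with y hy hU hfin
    rw [hf y hU hfin, hy, hsum m y hfin]
    have : ∀ j, coord (TropHopf.shift a (-k) y) j - coord x j =
        coord y j - coord (TropHopf.shift a k x) j := fun j => by
      rw [coord_shift (hfin j), coord_shift (hx j)]
      push_cast
      ring
    simp only [this]
    ring
  · refine Or.inr ⟨i, fun j => shift_eq_top.trans (hi j), m, c - ∑ j, (m j : ℝ) * (k * a j),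
      hm, ?_⟩
    filter_upwards [hlim.eventually h] with y hy hU hfin
    rw [hf y hU hfin, hy, hsum m y hfin]
    ring

/-- An invertible regular summand alters only `m` and `c`. At a boundary point its slope along the
infinite coordinate is zero, so the order there is also unchanged. -/
theorem RatFun.HasMult.of_sub {U V : Opens (Hopf a)} {f : RatFun U} {g : RatFun V}
    {x : Punctured d} {w : ℤ} (h : f.HasMult x w) (hx : proj a x ∈ U) {t : Punctured d → ℝ} {α}
    (ht : HasGerm t x α) (hfg : ∀ (y : Punctured d) (hU : proj a y ∈ U) (hV : proj a y ∈ V)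
      (hf : IsFinite y), g.toFun (finitePoint y hV hf) - f.toFun (finitePoint y hU hf) = t y) :
    g.HasMult x w := by
  have hsum : ∀ (m : Fin d → ℤ) (y : Punctured d),
      ∑ j, ((m + α.1) j : ℝ) * coord y j =
        ∑ j, (m j : ℝ) * coord y j + ∑ j, (α.1 j : ℝ) * coord y j := fun m y => by
    simp only [Pi.add_apply, Int.cast_add, add_mul, Finset.sum_add_distrib]
  rcases h with ⟨hfx, n, m, c, hn, h⟩ | ⟨i, hi, m, c, hm, h⟩
  · refine Or.inl ⟨hfx, n, m + α.1, c + α.2, hn, ?_⟩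
    filter_upwards [h, ht.2, eventually_proj_mem hx] with y hy hty hU hV hfin
    rw [eq_add_of_sub_eq (hfg y hU hV hfin), hy hU hfin, hty, hsum, affine]
    ring
  · refine Or.inr ⟨i, hi, m + α.1, c + α.2, by simp [hm, ht.1 i ((hi i).2 rfl)], ?_⟩
    filter_upwards [h, ht.2, eventually_proj_mem hx] with y hy hty hU hV hfin
    rw [eq_add_of_sub_eq (hfg y hU hV hfin), hy hU hfin, hty, hsum, affine]
    ring

/-- The weight is chosen from the predicate `HasMult`, so equivalent predicates yield the same
choice and no uniqueness of `w` is needed. -/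
theorem RatFun.mult_congr {U V : Opens (Hopf a)} {f : RatFun U} {g : RatFun V}
    {x y : Punctured d} (h : ∀ w, f.HasMult x w ↔ g.HasMult y w) : f.mult x = g.mult y := by
  have key : ∀ p q : ℤ → Prop, p = q → open Classical in
      (if h : ∃ w, p w then h.choose else 0) = (if h : ∃ w, q w then h.choose else 0) := by
    rintro p _ rfl
    rfl
  exact key _ _ (funext fun w => propext (h w))

theorem IsSectionOf.hasMult {τ : Cocycle U} {f : ∀ i, RatFun (U i)} (h : IsSectionOf τ f)
    {i j : ι} {x y : Punctured d} (hi : proj a x ∈ U i) (hj : proj a y ∈ U j)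
    (hxy : proj a x = proj a y) {w : ℤ} (hw : (f i).HasMult x w) : (f j).HasMult y w := by
  obtain ⟨k, rfl⟩ := exists_shift hxy
  rw [proj_shift] at hj
  refine RatFun.HasMult.shift ?_ k
  obtain ⟨α, hα⟩ := exists_hasGerm_pullback (τ.1 j i) (⟨hj, hi⟩ : proj a x ∈ U j ⊓ U i)
  refine hw.of_sub hi hα fun z hU hV hf => ?_
  rw [h j i z hV hU hf, pullback_apply (U := U j ⊓ U i) _ ⟨hV, hU⟩]

theorem IsSectionOf.exists_divisor {τ : Cocycle U} {f : ∀ i, RatFun (U i)} (h : IsSectionOf τ f)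
    (hU : ∀ p, ∃ i, p ∈ U i) : ∃ D : Divisor a, ∀ i, IsDivOf D.weight (f i) := by
  choose ind hind using hU
  -- The weight at `p` is computed with an arbitrary index and lift; `IsSectionOf.hasMult` shows
  -- independence of both.
  have hdiv : ∀ i, IsDivOf (fun p => (f (ind p)).mult (lift p)) (f i) := by
    intro i x hx
    have hx' : proj a (lift (proj a x)) ∈ U (ind (proj a x)) := by
      rw [proj_lift]
      exact hind _
    exact RatFun.mult_congr fun w => ⟨fun hw => h.hasMult hx' hx (proj_lift _) hw,
      fun hw => h.hasMult hx hx' (proj_lift _).symm hw⟩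
  exact ⟨⟨_, fun p => ⟨U (ind p), hind p, f (ind p), hdiv _⟩⟩, hdiv⟩

end

end TropHopf

theorem mainTheorem7 {d : ℕ} (hd : 2 ≤ d) (a : Fin d → ℝ) (ha : ∀ i, 0 < a i) :
    Nonempty (TropHopf.Pic a ≃+ ℝ) ∧
    (∀ c : TropHopf.Pic a, ∃ D : TropHopf.Divisor a, D.Represents c) ∧
    (∀ L : TropHopf.LineBundle a, ∃ (s : L.RatSection) (D : TropHopf.Divisor a),
      s.HasDivisor D ∧ D.Represents L.toPic) := by
  have : Nontrivial (Fin d) := Fin.nontrivial_iff_two_le.2 hd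
  refine ⟨TropHopf.Pic.nonempty_equiv_real ha, fun c => ?_, fun L => ?_⟩
  · obtain ⟨U, τ, rfl⟩ := TropHopf.Pic.exists_mk c
    obtain ⟨f, hf⟩ := TropHopf.exists_isSectionOf ha (fun p => ⟨p, U.2 p⟩) τ
    obtain ⟨D, hD⟩ := hf.exists_divisor fun p => ⟨p, U.2 p⟩
    exact ⟨D, U, f, τ, hD, hf, rfl⟩
  · obtain ⟨f, hf⟩ := TropHopf.exists_isSectionOf ha L.covers L.τ
    obtain ⟨D, hD⟩ := hf.exists_divisor L.covers
    -- The class `L.toPic` is defined by choosing an index at each point; the same choice of the `f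
    -- i` gives local equations of `D` with exactly that cocycle.
    exact ⟨⟨f, hf⟩, D, hD, _, fun p => f (L.covers p).choose, _, fun p => hD _,
      fun i j => hf _ _, rfl⟩
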